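/- Let $n\ge 1$ and let $h\colon\mathbb{R}\to\mathbb{R}$ be a $C^\infty$, even, $2\pi$-periodic function with $h''(0)=h''''(0)=0$ and $h''(\pi)=0$. For $\varepsilon\in\mathbb{R}$ put $g_\varepsilon=1+\varepsilon h$, $R_\varepsilon=g_\varepsilon(0)+g_\varepsilon(\pi)$, $\gamma_\varepsilon(t)=(g_\varepsilon(t)\sin t,\;g_\varepsilon(\pi)+g_\varepsilon(t)\cos t)$, and let $S_\varepsilon\subset\mathbb{R}^{n+1}$ be the hypersurface of revolution consisting of the points $g_\varepsilon(\theta)\,\omega+g_\varepsilon(\pi)\mathbf{e}_{n+1}$ with $\omega\in\mathbb{S}^n$ and $\theta\in[0,\pi]$ the angle between $\omega$ and $\mathbf{e}_{n+1}$. For $t\in[0,\pi]$ put, with $g=g_\varepsilon$, $$M_\varepsilon(t)=\frac1n\Big((n-1)\,\frac{g-\frac{\cos t}{\sin t}g'}{g\sqrt{g^2+(g')^2}}+\frac{g^2+2(g')^2-gg''}{[g^2+(g')^2]^{3/2}}\Big)$$ (extended by continuity to $t=0,\pi$). Then there is $\varepsilon_0>0$ such that for every $\varepsilon\in(-\varepsilon_0,\varepsilon_0)$: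 $g_\varepsilon>0$; $|\gamma_\varepsilon|$ maps $[0,\pi]$ bijectively onto $[0,R_\varepsilon]$, with $R_\varepsilon=\max_{[-\pi,\pi]}|\gamma_\varepsilon|$; and the radial function $H_\varepsilon\colon\mathbb{R}^{n+1}\to\mathbb{R}$, $$H_\varepsilon(p)=\begin{cases}g_\varepsilon(0)\,M_\varepsilon\big(|\gamma_\varepsilon|^{-1}(g_\varepsilon(0)|p|)\big)&\text{if }|p|\le R_\varepsilon/g_\varepsilon(0),\\[2pt]1&\text{if }|p|>R_\varepsilon/g_\varepsilon(0),\end{cases}$$ has the following properties. (1) $H_\varepsilon\in C^1(\mathbb{R}^{n+1})$. (2) There are $C_1,C_2>0$ with $C_1\le H_\varepsilon(p)\le C_2$ for all $p\in\mathbb{R}^{n+1}$. (3) For every $p\in\mathbb{R}^{n+1}$ there is an embedded smooth hypersurface $S$, diffeomorphic to $\mathbb{S}^n$, with $p\in S$, whose mean curvature (the average of the principal curvatures with respect to the outward normal, positive for round spheres) at each of its points $q$ equals $H_\varepsilon(q)$. In particular, $g_\varepsilon(0)^{-1}S_\varepsilon$ is an embedded hypersurface of this kind. Moreover, as $\varepsilon\to0$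 one has $R_\varepsilon\to2$, $R_\varepsilon/g_\varepsilon(0)\to 2$ and $H_\varepsilon\to1$ in $C^1(\mathbb{R}^{n+1})$ (that is, $H_\varepsilon\to 1$ and $\nabla H_\varepsilon\to 0$ uniformly). If $h$ vanishes in neighbourhoods of $0$ and $\pi$, then $H_\varepsilon\in C^\infty(\mathbb{R}^{n+1})$ for all $|\varepsilon|<\varepsilon_0$. -/

import Mathlib

open Set Filter Function
open scoped Topology Manifold ContDiff Pointwise

noncomputable section

/-! ### Profile curve and reference hypersurface -/

/-- `g_ε = 1 + ε h`. -/
def gEps (h : ℝ → ℝ) (ε t : ℝ) : ℝ := 1 + ε * h t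

/-- `γ_ε(t) = (g_ε(t) sin t, g_ε(π) + g_ε(t) cos t)`. -/
def profileCurve (h : ℝ → ℝ) (ε t : ℝ) : EuclideanSpace ℝ (Fin 2) :=
  !₂[gEps h ε t * Real.sin t, gEps h ε Real.pi + gEps h ε t * Real.cos t]

/-- `R_ε = g_ε(0) + g_ε(π)`. -/
def radiusEps (h : ℝ → ℝ) (ε : ℝ) : ℝ := gEps h ε 0 + gEps h ε Real.pi

/-- The hypersurface of revolution `S_ε ⊆ ℝ^{n+1}`: the points
`g_ε(θ) w + g_ε(π) e_{n+1}`, where `w` runs through the unit sphere and `θ ∈ [0, π]` is the angle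
between `w` and `e_{n+1}`. -/
def refHypersurface (n : ℕ) (h : ℝ → ℝ) (ε : ℝ) : Set (EuclideanSpace ℝ (Fin (n + 1))) :=
  {p | ∃ w ∈ Metric.sphere (0 : EuclideanSpace ℝ (Fin (n + 1))) 1,
    p = gEps h ε (Real.arccos (w (Fin.last n))) • w
      + gEps h ε Real.pi • EuclideanSpace.single (Fin.last n) (1 : ℝ)}

/-! ### Principal curvatures and the curvature function -/

/-- The principal curvatures `K_1 = ⋯ = K_{n-1}` of the hypersurface of revolution with polar
profile `g`, as a function of the polar angle. At the poles the formula is extended by continuity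
(for even `2π`-periodic `g`, the quotient `g' cos / sin` tends to `g''` there). -/
def parallelCurvature (g : ℝ → ℝ) (t : ℝ) : ℝ :=
  if Real.sin t = 0 then
    (g t - deriv (deriv g) t) / (g t * √(g t ^ 2 + deriv g t ^ 2))
  else
    (g t - Real.cos t / Real.sin t * deriv g t) / (g t * √(g t ^ 2 + deriv g t ^ 2))

/-- The principal curvature `K_n`, which is the curvature of the profile curve. -/
def meridianCurvature (g : ℝ → ℝ) (t : ℝ) : ℝ :=
  (g t ^ 2 + 2 * deriv g t ^ 2 - g t * deriv (deriv g) t)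
    / (g t ^ 2 + deriv g t ^ 2) ^ (3 / 2 : ℝ)

/-- The mean of the `n` principal curvatures at polar angle `t`. -/
def revolutionMeanCurvature (n : ℕ) (g : ℝ → ℝ) (t : ℝ) : ℝ :=
  (((n : ℝ) - 1) * parallelCurvature g t + meridianCurvature g t) / n

/-- The inverse of `|γ_ε| : [0, π] → [0, R_ε]`. -/
def angleOfDist (h : ℝ → ℝ) (ε r : ℝ) : ℝ :=
  invFunOn (fun t => ‖profileCurve h ε t‖) (Icc 0 Real.pi) r

/-- The curvature function `H_ε`: the mean curvature of the rescaled hypersurface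
`g_ε(0)⁻¹ S_ε`, as a function of the distance from the origin, extended by `1`. -/
def curvatureFun (n : ℕ) (h : ℝ → ℝ) (ε : ℝ) (p : EuclideanSpace ℝ (Fin (n + 1))) : ℝ :=
  if ‖p‖ ≤ radiusEps h ε / gEps h ε 0 then
    gEps h ε 0 * revolutionMeanCurvature n (gEps h ε) (angleOfDist h ε (gEps h ε 0 * ‖p‖))
  else 1

/-! ### Embedded hyperspheres and their mean curvature -/

/-- The unit sphere `𝕊^n` in `ℝ^{n+1}`. -/
abbrev UnitSphere (n : ℕ) : Type :=
  Metric.sphere (0 : EuclideanSpace ℝ (Fin (n + 1))) 1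

/-- `φ` is a smooth embedding of `𝕊^n` into `ℝ^{n+1}`: a smooth injective immersion (the domain is
compact). -/
def IsEmbeddedSphere {n : ℕ} (φ : UnitSphere n → EuclideanSpace ℝ (Fin (n + 1))) : Prop :=
  ContMDiff (𝓡 n) 𝓘(ℝ, EuclideanSpace ℝ (Fin (n + 1))) ∞ φ ∧ Injective φ ∧
    ∀ q, Injective (mvfderiv (𝓡 n) φ q)

/-- `N` is the smooth outward-pointing unit normal field along `φ`: just off the hypersurface in
the direction `N` one is in an unbounded component of the complement. -/
def IsOutwardUnitNormal {n : ℕ} (φ N : UnitSphere n → EuclideanSpace ℝ (Fin (n + 1))) : Prop :=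
  ContMDiff (𝓡 n) 𝓘(ℝ, EuclideanSpace ℝ (Fin (n + 1))) ∞ N ∧
    (∀ q, ‖N q‖ = 1) ∧
    (∀ q v, inner ℝ (N q) (mvfderiv (𝓡 n) φ q v) = 0) ∧
    ∀ q, ∀ᶠ t : ℝ in 𝓝[>] 0,
      ¬ Bornology.IsBounded (connectedComponentIn (range φ)ᶜ (φ q + t • N q))

/-- The mean curvature at `φ q` is `c`: `c` is the trace, divided by `n`, of the shape operator
`L_{φ q} : dφ(v) ↦ dN(v)`, read on the tangent space of `𝕊^n` at `q` through the isomorphism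
`dφ`. -/
def HasMeanCurvatureAt {n : ℕ} (φ N : UnitSphere n → EuclideanSpace ℝ (Fin (n + 1)))
    (q : UnitSphere n) (c : ℝ) : Prop :=
  ∃ L : TangentSpace (𝓡 n) q →ₗ[ℝ] TangentSpace (𝓡 n) q,
    (∀ v, mvfderiv (𝓡 n) N q v = mvfderiv (𝓡 n) φ q (L v)) ∧
      c = LinearMap.trace ℝ (TangentSpace (𝓡 n) q) L / n

/-- `S` is an embedded hypersurface of `ℝ^{n+1}`, diffeomorphic to `𝕊^n`, whose mean curvature
(with respect to the outward normal) at each of its points `p` is `H p`. -/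
def IsBubble {n : ℕ} (H : EuclideanSpace ℝ (Fin (n + 1)) → ℝ)
    (S : Set (EuclideanSpace ℝ (Fin (n + 1)))) : Prop :=
  ∃ φ N : UnitSphere n → EuclideanSpace ℝ (Fin (n + 1)),
    range φ = S ∧ IsEmbeddedSphere φ ∧ IsOutwardUnitNormal φ N ∧
      ∀ q, HasMeanCurvatureAt φ N q (H (φ q))

end

/-! ### Smooth even periodic functions as smooth functions of the cosine -/

/-! Everything is expressed through the cosine `x` of the polar angle. Dividing the derivative of a
smooth even 2π-periodic function by `sin` stays in this class, so integrating repeatedly with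
respect to the cosine writes the function as `k (cos t)` with `k` of any prescribed finite order
(`exists_contDiff_comp_cos`). The hypersurfaces become zonal graphs `w ↦ c k(⟨e, w⟩) w + v` over the
sphere, with no singularity at the poles. Their shape operator is a multiple of the identity plus an
operator of rank at most one, so the mean curvature is an explicit function `m(x)` of `k`, `k'`,
`k''` (`hasMeanCurvatureAt_zonalGraph`).

Translate the graph so that its point with `x = -1` is the origin. The squared distance to the
origin is then a function `F(x)` of `x` alone, with `F' = 2` for the round unit sphere. Hence for
small `ε` the function `F` is increasing on `[-1, 1]`, and `m` is a `C^1` function of `F`. Up to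
scaling, `H_ε` is this function of `|p|²`, so the origin needs no special care. At the other end,
`h''(0) = h''''(0) = 0` means that `k` has zero first and second derivatives at `x = 1`. This gives
`k(1) m(1) = 1` and `m'(1) = 0`, so the extension by the constant `1` is `C^1`
(`exists_factorization`, `deriv_zonalMeanCurvature_one`).

Since `H_ε` is radial, the scaled hypersurface may be moved by any linear isometry, and its
distances to the origin fill the whole interval, so some copy passes through any given point of the
ball. Outside the ball `H_ε = 1`, and unit spheres avoiding the ball do. The estimates uniform in
`x` follow from joint continuity in `(ε, x)` at `ε = 0`, the round sphere, and compactness of `[-1,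
1]`. -/

theorem hasDerivAt_integral_pow_mul_dilation {f : ℝ → ℝ} (hf : ContDiff ℝ 1 f) (j : ℕ)
    (a t : ℝ) :
    HasDerivAt (fun t => ∫ s in (0 : ℝ)..1, s ^ j * f (a + s * (t - a)))
      (∫ s in (0 : ℝ)..1, s ^ (j + 1) * deriv f (a + s * (t - a))) t := by
  have hc : Continuous f := hf.continuous
  have hc' : Continuous (deriv f) := hf.continuous_deriv le_rfl
  obtain ⟨C, hC⟩ := ((isCompact_Icc (a := (0 : ℝ)) (b := 1)).prod
    (isCompact_closedBall t 1)).exists_bound_of_continuousOn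
    (f := fun p : ℝ × ℝ => p.1 ^ (j + 1) * deriv f (a + p.1 * (p.2 - a)))
    (by fun_prop)
  refine (intervalIntegral.hasDerivAt_integral_of_dominated_loc_of_deriv_le
    (F' := fun t s => s ^ (j + 1) * deriv f (a + s * (t - a))) (bound := fun _ => C)
    (Metric.closedBall_mem_nhds t one_pos) ?_ ?_ ?_ ?_ ?_ ?_).2
  · exact Eventually.of_forall fun x => (by fun_prop : Continuous _).aestronglyMeasurable
  · exact (by fun_prop : Continuous _).intervalIntegrable _ _
  · exact (by fun_prop : Continuous _).aestronglyMeasurable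
  · refine Eventually.of_forall fun s hs x hx => hC (s, x) ⟨?_, hx⟩
    rw [uIoc_of_le zero_le_one] at hs
    exact ⟨hs.1.le, hs.2⟩
  · exact intervalIntegrable_const
  · refine Eventually.of_forall fun s _ x _ => ?_
    have h1 : HasDerivAt (fun x => a + s * (x - a)) s x := by
      simpa using (((hasDerivAt_id x).sub_const a).const_mul s).const_add a
    have h2 := ((hf.differentiable one_ne_zero).differentiableAt.hasDerivAt.comp x h1).const_mul
      (s ^ j)
    convert! h2 using 1
    ring

/-- The weight `s ^ j` makes the induction close: differentiating in `t` turns the pair `(f, j)`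
into `(f', j + 1)`. -/
theorem contDiff_integral_pow_mul_dilation (N : ℕ) : ∀ (f : ℝ → ℝ) (j : ℕ) (a : ℝ),
    ContDiff ℝ N f → ContDiff ℝ N (fun t => ∫ s in (0 : ℝ)..1, s ^ j * f (a + s * (t - a))) := by
  induction N with
  | zero =>
    intro f j a hf
    have hc : Continuous f := hf.continuous
    refine contDiff_zero.2 (intervalIntegral.continuous_parametric_intervalIntegral_of_continuous'
      (f := fun t s => s ^ j * f (a + s * (t - a))) ?_ 0 1)
    simp only [uncurry_def]
    fun_prop
  | succ N ih =>
    intro f j a hf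
    have hf' : ContDiff ℝ ((N : ℕ∞ω) + 1) f := by exact_mod_cast hf
    have h1 : ContDiff ℝ 1 f := hf'.of_le (by simp)
    have key := hasDerivAt_integral_pow_mul_dilation h1 j a
    push_cast
    refine contDiff_succ_iff_deriv.2 ⟨fun t => (key t).differentiableAt, by simp, ?_⟩
    rw [funext fun t => (key t).deriv]
    exact ih _ _ _ (contDiff_succ_iff_deriv.1 hf').2.2

/-- Hadamard's lemma on the line. -/
theorem exists_contDiff_eq_sub_mul {f : ℝ → ℝ} (hf : ContDiff ℝ ∞ f) {a : ℝ} (ha : f a = 0) :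
    ∃ u : ℝ → ℝ, ContDiff ℝ ∞ u ∧ (∀ t, f t = (t - a) * u t) ∧ u a = deriv f a := by
  have hf' : ContDiff ℝ ∞ (deriv f) := hf.iterate_deriv 1
  refine ⟨fun t => ∫ s in (0 : ℝ)..1, deriv f (a + s * (t - a)), ?_, ?_, by simp⟩
  · refine contDiff_infty.2 fun N => ?_
    simpa using contDiff_integral_pow_mul_dilation N (deriv f) 0 a (contDiff_infty.1 hf' N)
  · intro t
    have h1 : ∀ s : ℝ, HasDerivAt (fun s => f (a + s * (t - a)))
        ((t - a) * deriv f (a + s * (t - a))) s := fun s => by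
      have h1 : HasDerivAt (fun s => a + s * (t - a)) (t - a) s := by
        simpa using ((hasDerivAt_id s).mul_const (t - a)).const_add a
      have := ((hf.differentiable (by simp)).differentiableAt.hasDerivAt.comp s h1)
      rwa [mul_comm] at this
    have hc' : Continuous (deriv f) := hf'.continuous
    have h2 := intervalIntegral.integral_eq_sub_of_hasDerivAt (a := 0) (b := 1)
      (fun s _ => h1 s) ((by fun_prop : Continuous _).intervalIntegrable _ _)
    rw [← intervalIntegral.integral_const_mul, h2]
    simp [ha]

/-- The quotient `f / sin`, with its limit `f' / cos` at the zeros of `sin`. -/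
noncomputable def divSin (f : ℝ → ℝ) (t : ℝ) : ℝ :=
  if Real.sin t = 0 then deriv f t / Real.cos t else f t / Real.sin t

theorem cos_ne_zero_of_sin_eq_zero {t : ℝ} (ht : Real.sin t = 0) : Real.cos t ≠ 0 := by
  intro h
  have := Real.sin_sq_add_cos_sq t
  simp [h, ht] at this

theorem sin_mul_divSin {f : ℝ → ℝ} (h0 : ∀ t, Real.sin t = 0 → f t = 0) (t : ℝ) :
    Real.sin t * divSin f t = f t := by
  by_cases ht : Real.sin t = 0
  · simp [ht, h0 t ht]
  · rw [divSin, if_neg ht]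
    field_simp

/-- Near a zero `a` of `sin`, both `f` and `sin` are `t - a` times a smooth factor by Hadamard's
lemma, and the factor of `sin` is nonzero at `a`. -/
theorem contDiff_divSin {f : ℝ → ℝ} (hf : ContDiff ℝ ∞ f)
    (h0 : ∀ t, Real.sin t = 0 → f t = 0) : ContDiff ℝ ∞ (divSin f) := by
  rw [contDiff_iff_contDiffAt]
  intro a
  by_cases ha : Real.sin a = 0
  · obtain ⟨u, hu, hu1, hu2⟩ := exists_contDiff_eq_sub_mul hf (h0 a ha)
    obtain ⟨s, hs, hs1, hs2⟩ := exists_contDiff_eq_sub_mul Real.contDiff_sin ha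
    rw [Real.deriv_sin] at hs2
    have hsa : s a ≠ 0 := hs2 ▸ cos_ne_zero_of_sin_eq_zero ha
    refine (hu.contDiffAt.div hs.contDiffAt hsa).congr_of_eventuallyEq ?_
    filter_upwards [hs.continuous.continuousAt.eventually_ne hsa] with t ht
    rcases eq_or_ne t a with rfl | hta
    · simp [divSin, ha, hu2, hs2]
    · have h3 : Real.sin t ≠ 0 := by
        rw [hs1]
        exact mul_ne_zero (sub_ne_zero.2 hta) ht
      rw [divSin, if_neg h3, hu1 t, hs1 t, mul_div_mul_left _ _ (sub_ne_zero.2 hta), Pi.div_apply]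
  · refine (hf.contDiffAt.div Real.contDiff_sin.contDiffAt ha).congr_of_eventuallyEq ?_
    filter_upwards [Real.continuous_sin.continuousAt.eventually_ne ha] with t ht
    simp [divSin, ht]

theorem divSin_even {f : ℝ → ℝ} (hf : ∀ t, f (-t) = -f t) : Function.Even (divSin f) := by
  intro t
  have h1 : deriv f (-t) = deriv f t := by
    have h2 : deriv (fun t => f (-t)) t = deriv (fun t => -f t) t := by simp only [hf]
    rw [deriv_comp_neg, deriv.fun_neg] at h2
    linarith
  simp [divSin, hf, h1]

theorem divSin_periodic {f : ℝ → ℝ} (hf : Function.Periodic f (2 * Real.pi)) :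
    Function.Periodic (divSin f) (2 * Real.pi) := by
  intro t
  have h1 : deriv f (t + 2 * Real.pi) = deriv f t := by
    rw [← deriv_comp_add_const, funext hf]
  simp [divSin, hf t, h1]

/-- `g` is smooth, even and `2π`-periodic. -/
def SmoothEvenPeriodic (g : ℝ → ℝ) : Prop :=
  ContDiff ℝ ∞ g ∧ Function.Even g ∧ Function.Periodic g (2 * Real.pi)

namespace SmoothEvenPeriodic

variable {g : ℝ → ℝ}

theorem deriv_neg (hg : SmoothEvenPeriodic g) (t : ℝ) : deriv g (-t) = -deriv g t := by
  have h2 : deriv (fun t => g (-t)) t = deriv g t := by rw [funext hg.2.1]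
  rw [deriv_comp_neg] at h2
  linarith

theorem deriv_periodic (hg : SmoothEvenPeriodic g) :
    Function.Periodic (deriv g) (2 * Real.pi) := by
  intro t
  rw [← deriv_comp_add_const, funext hg.2.2]

/-- The derivative is odd and 2π-periodic, so at a multiple of `π` it equals its own negative. -/
theorem deriv_eq_zero (hg : SmoothEvenPeriodic g) {t : ℝ} (ht : Real.sin t = 0) :
    deriv g t = 0 := by
  obtain ⟨n, rfl⟩ := Real.sin_eq_zero_iff.1 ht
  have h1 : deriv g (-(n * Real.pi) + n * (2 * Real.pi)) = deriv g (-(n * Real.pi)) :=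
    hg.deriv_periodic.int_mul n _
  rw [show -(n * Real.pi) + n * (2 * Real.pi) = n * Real.pi by ring, hg.deriv_neg] at h1
  linarith

/-- The derivative of `g` with respect to the cosine. -/
theorem exists_derivCos (hg : SmoothEvenPeriodic g) :
    ∃ q, SmoothEvenPeriodic q ∧ ∀ t, deriv g t = -(Real.sin t * q t) := by
  have hs : ContDiff ℝ ∞ (deriv g) := hg.1.iterate_deriv 1
  have h0 : ∀ t, Real.sin t = 0 → deriv g t = 0 := fun t => hg.deriv_eq_zero
  refine ⟨fun t => -divSin (deriv g) t, ⟨(contDiff_divSin hs h0).neg, fun t => ?_, fun t => ?_⟩,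
    fun t => ?_⟩
  · simp only [divSin_even hg.deriv_neg t]
  · simp only [divSin_periodic hg.deriv_periodic t]
  · linarith [sin_mul_divSin h0 t]

theorem apply_arccos_cos (hg : SmoothEvenPeriodic g) (t : ℝ) :
    g (Real.arccos (Real.cos t)) = g t := by
  have h1 : Real.cos (Real.arccos (Real.cos t)) = Real.cos t :=
    Real.cos_arccos (Real.neg_one_le_cos t) (Real.cos_le_one t)
  obtain ⟨n, hn⟩ := Real.cos_eq_cos_iff.1 h1
  generalize Real.arccos (Real.cos t) = a at hn
  rcases hn with rfl | rfl
  · rw [show 2 * n * Real.pi + a = a + n * (2 * Real.pi) by ring, hg.2.2.int_mul n a]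
  · rw [show 2 * n * Real.pi - a = -a + n * (2 * Real.pi) by ring, hg.2.2.int_mul n (-a), hg.2.1]

/-- Integration with respect to the cosine. -/
theorem exists_primitive (hg : SmoothEvenPeriodic g) {k₁ : ℝ → ℝ} (hk₁ : Continuous k₁)
    (h : ∀ t, deriv g t = -(Real.sin t * k₁ (Real.cos t))) :
    ∃ k : ℝ → ℝ, (∀ x, HasDerivAt k (k₁ x) x) ∧ ∀ t, k (Real.cos t) = g t := by
  have hd : ∀ x, HasDerivAt (fun x => g 0 + ∫ y in (1 : ℝ)..x, k₁ y) (k₁ x) x := fun x =>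
    (hk₁.integral_hasStrictDerivAt 1 x).hasDerivAt.const_add (g 0)
  refine ⟨_, hd, fun t => ?_⟩
  have hconst : ∀ t, HasDerivAt
      (fun t => (g 0 + ∫ y in (1 : ℝ)..Real.cos t, k₁ y) - g t) 0 t := fun t => by
    have := ((hd (Real.cos t)).comp t (Real.hasDerivAt_cos t)).sub
      (hg.1.differentiable (by simp) t).hasDerivAt
    convert! this using 1
    rw [h t]
    ring
  have := is_const_of_deriv_eq_zero (fun t => (hconst t).differentiableAt)
    (fun t => (hconst t).deriv) t 0
  simp only [Real.cos_zero, intervalIntegral.integral_same, add_zero, sub_self] at this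
  linarith

/-- Each integration with respect to the cosine gains one order of differentiability, starting from
the continuous function `g ∘ arccos`. The representative depends on `N` off `[-1, 1]`. -/
theorem exists_contDiff_comp_cos (N : ℕ) : ∀ {g : ℝ → ℝ}, SmoothEvenPeriodic g →
    ∃ k : ℝ → ℝ, ContDiff ℝ N k ∧ ∀ t, k (Real.cos t) = g t := by
  induction N with
  | zero =>
    intro g hg
    exact ⟨fun x => g (Real.arccos x),
      contDiff_zero.2 (hg.1.continuous.comp Real.continuous_arccos), hg.apply_arccos_cos⟩
  | succ N ih =>
    intro g hg
    obtain ⟨q, hq, hgq⟩ := hg.exists_derivCos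
    obtain ⟨k₁, hk₁, hkq⟩ := ih hq
    obtain ⟨k, hk, hkg⟩ := hg.exists_primitive hk₁.continuous (fun t => by rw [hkq, hgq])
    refine ⟨k, ?_, hkg⟩
    push_cast
    refine contDiff_succ_iff_deriv.2 ⟨fun x => (hk x).differentiableAt, by simp, ?_⟩
    rwa [funext fun x => (hk x).deriv]

end SmoothEvenPeriodic

/-- `f` is a smooth function of `cos t`. -/
def SmoothInCos (f : ℝ → ℝ) : Prop := ContDiff ℝ ∞ fun t => f (Real.cos t)

theorem SmoothInCos.smoothEvenPeriodic {f : ℝ → ℝ} (hf : SmoothInCos f) :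
    SmoothEvenPeriodic fun t => f (Real.cos t) :=
  ⟨hf, fun t => by simp, fun t => by simp⟩

theorem SmoothInCos.exists_contDiff_eqOn {f : ℝ → ℝ} (hf : SmoothInCos f) (N : ℕ) :
    ∃ k : ℝ → ℝ, ContDiff ℝ N k ∧ EqOn k f (Icc (-1) 1) := by
  obtain ⟨k, hk, h⟩ := SmoothEvenPeriodic.exists_contDiff_comp_cos N hf.smoothEvenPeriodic
  refine ⟨k, hk, fun x hx => ?_⟩
  have := h (Real.arccos x)
  rwa [Real.cos_arccos hx.1 hx.2] at this

/-- The unit normal involves the derivative of the profile as well. One profile of finite order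
suffices for a smooth normal field, provided this derivative is also smooth in the cosine. -/
theorem SmoothEvenPeriodic.exists_contDiff_smoothInCos {g : ℝ → ℝ} (hg : SmoothEvenPeriodic g)
    (N : ℕ) : ∃ k : ℝ → ℝ, ContDiff ℝ (N + 1) k ∧ (∀ t, k (Real.cos t) = g t) ∧
      SmoothInCos (deriv k) := by
  obtain ⟨q, hq, hgq⟩ := hg.exists_derivCos
  obtain ⟨k₁, hk₁, hkq⟩ := SmoothEvenPeriodic.exists_contDiff_comp_cos N hq
  obtain ⟨k, hk, hkg⟩ := hg.exists_primitive hk₁.continuous (fun t => by rw [hkq, hgq])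
  have hd : deriv k = k₁ := funext fun x => (hk x).deriv
  refine ⟨k, contDiff_succ_iff_deriv.2 ⟨fun x => (hk x).differentiableAt, by simp, ?_⟩, hkg, ?_⟩
  · rwa [hd]
  · rw [SmoothInCos, hd, funext hkq]
    exact hq.1

/-! ### Zonal radial graphs over the sphere -/

section Profile

/-- For a profile `k` as a function of the cosine, the length of the normal vector
`(k + x k') w - k' e` at a point `w` of the sphere with `x = ⟨e, w⟩`. -/
noncomputable def zonalSpeed (k : ℝ → ℝ) (x : ℝ) : ℝ := √(k x ^ 2 + (1 - x ^ 2) * deriv k x ^ 2)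

/-- The coefficient of `w` in the unit normal. -/
noncomputable def radialCoeff (k : ℝ → ℝ) (x : ℝ) : ℝ := (k x + x * deriv k x) / zonalSpeed k x

/-- The coefficient of the axis in the unit normal. -/
noncomputable def axialCoeff (k : ℝ → ℝ) (x : ℝ) : ℝ := -deriv k x / zonalSpeed k x

/-- The mean curvature of the zonal radial graph, as a function of the cosine. -/
noncomputable def zonalMeanCurvature (n : ℕ) (k : ℝ → ℝ) (x : ℝ) : ℝ :=
  (((n : ℝ) - 1) * ((k x + x * deriv k x) / (k x * zonalSpeed k x)) +
    (k x ^ 2 + 2 * (1 - x ^ 2) * deriv k x ^ 2 + x * k x * deriv k x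
      - (1 - x ^ 2) * k x * deriv (deriv k) x) / zonalSpeed k x ^ 3) / n

variable {k : ℝ → ℝ} {x : ℝ}

theorem zonalSpeed_radicand_pos (hx : x ∈ Icc (-1 : ℝ) 1) (hk : 0 < k x) :
    0 < k x ^ 2 + (1 - x ^ 2) * deriv k x ^ 2 := by
  have : 0 ≤ 1 - x ^ 2 := by nlinarith [hx.1, hx.2]
  positivity

theorem zonalSpeed_pos (hx : x ∈ Icc (-1 : ℝ) 1) (hk : 0 < k x) : 0 < zonalSpeed k x :=
  Real.sqrt_pos.2 (zonalSpeed_radicand_pos hx hk)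

theorem zonalSpeed_sq (hx : x ∈ Icc (-1 : ℝ) 1) (hk : 0 < k x) :
    zonalSpeed k x ^ 2 = k x ^ 2 + (1 - x ^ 2) * deriv k x ^ 2 :=
  Real.sq_sqrt (zonalSpeed_radicand_pos hx hk).le

theorem cos_mem_Icc_neg_one_one (t : ℝ) : Real.cos t ∈ Icc (-1 : ℝ) 1 :=
  ⟨Real.neg_one_le_cos t, Real.cos_le_one t⟩

theorem SmoothInCos.zonalSpeed (hk : SmoothInCos k) (hk' : SmoothInCos (deriv k))
    (hpos : ∀ x ∈ Icc (-1 : ℝ) 1, 0 < k x) : SmoothInCos (zonalSpeed k) := by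
  have h1 : ContDiff ℝ ∞ fun t => k (Real.cos t) ^ 2
      + (1 - Real.cos t ^ 2) * deriv k (Real.cos t) ^ 2 :=
    (ContDiff.pow hk 2).add ((contDiff_const.sub (Real.contDiff_cos.pow 2)).mul
      (ContDiff.pow hk' 2))
  exact h1.sqrt fun t => (zonalSpeed_radicand_pos (cos_mem_Icc_neg_one_one t)
    (hpos _ (cos_mem_Icc_neg_one_one t))).ne'

theorem SmoothInCos.radialCoeff (hk : SmoothInCos k) (hk' : SmoothInCos (deriv k))
    (hpos : ∀ x ∈ Icc (-1 : ℝ) 1, 0 < k x) : SmoothInCos (radialCoeff k) :=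
  ContDiff.div (ContDiff.add hk (Real.contDiff_cos.mul hk')) (hk.zonalSpeed hk' hpos)
    fun t => (zonalSpeed_pos (cos_mem_Icc_neg_one_one t) (hpos _ (cos_mem_Icc_neg_one_one t))).ne'

theorem SmoothInCos.axialCoeff (hk : SmoothInCos k) (hk' : SmoothInCos (deriv k))
    (hpos : ∀ x ∈ Icc (-1 : ℝ) 1, 0 < k x) : SmoothInCos (axialCoeff k) :=
  ContDiff.div (ContDiff.neg hk') (hk.zonalSpeed hk' hpos)
    fun t => (zonalSpeed_pos (cos_mem_Icc_neg_one_one t) (hpos _ (cos_mem_Icc_neg_one_one t))).ne'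

theorem hasDerivAt_zonalSpeed (hk : ContDiff ℝ 2 k) (hx : x ∈ Icc (-1 : ℝ) 1) (hpos : 0 < k x) :
    HasDerivAt (zonalSpeed k) ((k x * deriv k x - x * deriv k x ^ 2
      + (1 - x ^ 2) * deriv k x * deriv (deriv k) x) / zonalSpeed k x) x := by
  have h1 : HasDerivAt k (deriv k x) x := (hk.differentiable (by simp) x).hasDerivAt
  have hk' : ContDiff ℝ 1 (deriv k) := (contDiff_succ_iff_deriv (n := 1).1
    (by simpa [one_add_one_eq_two] using hk)).2.2
  have h2 : HasDerivAt (deriv k) (deriv (deriv k) x) x :=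
    (hk'.differentiable (by simp) x).hasDerivAt
  have h3 := ((h1.pow 2).add ((((hasDerivAt_id x).pow 2).const_sub 1).mul (h2.pow 2))).sqrt
    (zonalSpeed_radicand_pos hx hpos).ne'
  convert! h3 using 1
  simp only [zonalSpeed, Pi.add_apply, Pi.pow_apply, Pi.mul_apply, id]
  rw [div_eq_div_iff (by have := zonalSpeed_pos hx hpos; exact this.ne')
    (by have := zonalSpeed_pos hx hpos; exact (mul_pos two_pos this).ne')]
  push_cast
  ring

/-- The derivatives of the coefficients of the unit normal; the first is determined by the
second because the normal is orthogonal to the graph. -/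
theorem exists_hasDerivAt_coeff (hk : ContDiff ℝ 2 k) (hx : x ∈ Icc (-1 : ℝ) 1)
    (hpos : 0 < k x) :
    ∃ a' b' : ℝ, HasDerivAt (radialCoeff k) a' x ∧ HasDerivAt (axialCoeff k) b' x ∧
      k x * a' + x * k x * b' = deriv k x * (radialCoeff k x + (1 - x ^ 2) * b') ∧
      radialCoeff k x / k x + (1 - x ^ 2) * (b' / k x) =
        (k x ^ 2 + 2 * (1 - x ^ 2) * deriv k x ^ 2 + x * k x * deriv k x
          - (1 - x ^ 2) * k x * deriv (deriv k) x) / zonalSpeed k x ^ 3 := by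
  have h1 : HasDerivAt k (deriv k x) x := (hk.differentiable (by simp) x).hasDerivAt
  have hk' : ContDiff ℝ 1 (deriv k) := (contDiff_succ_iff_deriv (n := 1).1
    (by simpa [one_add_one_eq_two] using hk)).2.2
  have h2 : HasDerivAt (deriv k) (deriv (deriv k) x) x :=
    (hk'.differentiable (by simp) x).hasDerivAt
  have hW := hasDerivAt_zonalSpeed hk hx hpos
  have hWpos := zonalSpeed_pos hx hpos
  have hWsq := zonalSpeed_sq hx hpos
  refine ⟨_, _, (h1.add ((hasDerivAt_id' x).mul h2)).div hW hWpos.ne', h2.neg.div hW hWpos.ne',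
    ?_, ?_⟩
  -- Once denominators are cleared, the identity is a multiple of `W² = p² + (1 - x²) q²`; the same
  -- holds for the second one.
  · simp only [radialCoeff, Pi.add_apply, Pi.mul_apply, Pi.neg_apply]
    generalize zonalSpeed k x = W at *
    generalize deriv (deriv k) x = r at *
    generalize deriv k x = q at *
    generalize k x = p at *
    field_simp
    linear_combination (2 * p * q - q * (p + q * x) + q * (1 - x ^ 2) * r) * hWsq
  · simp only [radialCoeff, Pi.neg_apply]
    generalize zonalSpeed k x = W at *
    generalize deriv (deriv k) x = r at *
    generalize deriv k x = q at *
    generalize k x = p at *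
    field_simp
    linear_combination (p + x * q - (1 - x ^ 2) * r) * hWsq

end Profile

/-! ### Differentials of zonal maps on the unit sphere -/

theorem contMDiff_coe_unitSphere (n : ℕ) {m : ℕ∞ω} :
    ContMDiff (𝓡 n) 𝓘(ℝ, EuclideanSpace ℝ (Fin (n + 1))) m
      (Subtype.val : UnitSphere n → EuclideanSpace ℝ (Fin (n + 1))) := by
  have := Fact.mk (@finrank_euclideanSpace_fin ℝ _ (n + 1))
  exact contMDiff_coe_sphere

theorem injective_mvfderiv_coe_unitSphere {n : ℕ} (q : UnitSphere n) :
    Injective (mvfderiv (𝓡 n) (Subtype.val : UnitSphere n → EuclideanSpace ℝ (Fin (n + 1))) q) := by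
  have := Fact.mk (@finrank_euclideanSpace_fin ℝ _ (n + 1))
  exact injective_mvfderiv_subtypeVal_sphere q

theorem inner_eq_zero_iff_exists_mvfderiv_coe {n : ℕ} (q : UnitSphere n)
    (u : EuclideanSpace ℝ (Fin (n + 1))) :
    inner ℝ (q : EuclideanSpace ℝ (Fin (n + 1))) u = 0 ↔ ∃ v,
      mvfderiv (𝓡 n) (Subtype.val : UnitSphere n → EuclideanSpace ℝ (Fin (n + 1))) q v = u := by
  have := Fact.mk (@finrank_euclideanSpace_fin ℝ _ (n + 1))
  rw [← Submodule.mem_orthogonal_singleton_iff_inner_right (𝕜 := ℝ),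
    ← range_mvfderiv_subtypeVal (n := n)]
  rfl

theorem mvfderiv_comp_coe_unitSphere {n : ℕ} {G : Type*} [NormedAddCommGroup G] [NormedSpace ℝ G]
    {f : EuclideanSpace ℝ (Fin (n + 1)) → G} {f' : EuclideanSpace ℝ (Fin (n + 1)) →L[ℝ] G}
    {q : UnitSphere n} (hf : HasFDerivAt f f' q) :
    mvfderiv (𝓡 n) (fun q : UnitSphere n => f q) q =
      f' ∘L mvfderiv (𝓡 n) (Subtype.val : UnitSphere n → EuclideanSpace ℝ (Fin (n + 1))) q := by
  have h1 : MDifferentiableAt (𝓡 n) 𝓘(ℝ, EuclideanSpace ℝ (Fin (n + 1)))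
      (Subtype.val : UnitSphere n → EuclideanSpace ℝ (Fin (n + 1))) q :=
    (contMDiff_coe_unitSphere n (m := 1) q).mdifferentiableAt one_ne_zero
  have := (hf.hasMFDerivAt.comp q h1.hasMFDerivAt).mfderiv
  ext v
  simp only [mvfderiv]
  change mfderiv (𝓡 n) 𝓘(ℝ, G) (f ∘ Subtype.val) q v = _
  rw [this]
  rfl

theorem inner_mem_Icc {n : ℕ} {e w : EuclideanSpace ℝ (Fin (n + 1))} (he : ‖e‖ = 1)
    (hw : ‖w‖ = 1) : inner ℝ e w ∈ Icc (-1 : ℝ) 1 := by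
  have := abs_real_inner_le_norm e w
  rw [he, hw, mul_one] at this
  exact abs_le.1 this

/-- Off `[-1, 1]` nothing is known about `f`, so for each finite order it is replaced by a
representative that agrees with it on the range of `⟨e, ·⟩`. -/
theorem SmoothInCos.contMDiff {n : ℕ} {f : ℝ → ℝ} (hf : SmoothInCos f)
    {e : EuclideanSpace ℝ (Fin (n + 1))} (he : ‖e‖ = 1) :
    ContMDiff (𝓡 n) 𝓘(ℝ, ℝ) ∞ fun w : UnitSphere n => f (inner ℝ e (w : EuclideanSpace ℝ _)) := by
  rw [contMDiff_infty]
  intro N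
  obtain ⟨k, hk, hkf⟩ := hf.exists_contDiff_eqOn N
  have h1 : ContDiff ℝ N fun w : EuclideanSpace ℝ (Fin (n + 1)) => k (inner ℝ e w) :=
    hk.comp (contDiff_const.inner ℝ contDiff_id)
  have h2 := h1.contMDiff.comp (contMDiff_coe_unitSphere n (m := N))
  refine h2.congr fun w => ?_
  exact (hkf (inner_mem_Icc he (by simp))).symm

/-- The zonal radial graph with profile `k`, axis `e`, scaling `c` and translation `v`. -/
noncomputable def zonalGraph {n : ℕ} (k : ℝ → ℝ) (c : ℝ) (e v w : EuclideanSpace ℝ (Fin (n + 1))) :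
    EuclideanSpace ℝ (Fin (n + 1)) :=
  c • k (inner ℝ e w) • w + v

/-- The unit normal of the zonal radial graph. -/
noncomputable def zonalNormal {n : ℕ} (k : ℝ → ℝ) (e w : EuclideanSpace ℝ (Fin (n + 1))) :
    EuclideanSpace ℝ (Fin (n + 1)) :=
  radialCoeff k (inner ℝ e w) • w + axialCoeff k (inner ℝ e w) • e

section

variable {n : ℕ} {k : ℝ → ℝ} {c : ℝ} {e v : EuclideanSpace ℝ (Fin (n + 1))}

theorem SmoothInCos.contMDiff_zonalGraph (hk : SmoothInCos k) (he : ‖e‖ = 1) :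
    ContMDiff (𝓡 n) 𝓘(ℝ, EuclideanSpace ℝ (Fin (n + 1))) ∞
      fun w : UnitSphere n => zonalGraph k c e v w := by
  have h1 := (hk.contMDiff he).smul (contMDiff_coe_unitSphere n)
  exact ((contDiff_const_smul c).contMDiff.comp h1).add contMDiff_const

theorem SmoothInCos.contMDiff_zonalNormal (hk : SmoothInCos k) (hk' : SmoothInCos (deriv k))
    (hpos : ∀ x ∈ Icc (-1 : ℝ) 1, 0 < k x) (he : ‖e‖ = 1) :
    ContMDiff (𝓡 n) 𝓘(ℝ, EuclideanSpace ℝ (Fin (n + 1))) ∞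
      fun w : UnitSphere n => zonalNormal k e w :=
  (((hk.radialCoeff hk' hpos).contMDiff he).smul (contMDiff_coe_unitSphere n)).add
    (((hk.axialCoeff hk' hpos).contMDiff he).smul contMDiff_const)

theorem mvfderiv_zonalGraph (hk : ContDiff ℝ 2 k) (q : UnitSphere n)
    (u : TangentSpace (𝓡 n) q) :
    mvfderiv (𝓡 n) (fun w : UnitSphere n => zonalGraph k c e v w) q u =
      c • (k (inner ℝ e q.1) • mvfderiv (𝓡 n) (Subtype.val : UnitSphere n → _) q u +
        (deriv k (inner ℝ e q.1) *
          inner ℝ e (mvfderiv (𝓡 n) (Subtype.val : UnitSphere n → _) q u)) • q.1) := by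
  have h0 : HasFDerivAt (fun w => inner ℝ e w) (innerSL ℝ e) q.1 :=
    (innerSL ℝ e).hasFDerivAt
  have h1 := ((((hk.differentiable (by simp) _).hasDerivAt.comp_hasFDerivAt q.1 h0).smul
    (hasFDerivAt_id q.1)).const_smul c).add_const v
  rw [mvfderiv_comp_coe_unitSphere (f := fun w => zonalGraph k c e v w) h1]
  simp [mul_smul]

theorem mvfderiv_zonalNormal {q : UnitSphere n} {a' b' : ℝ}
    (ha : HasDerivAt (radialCoeff k) a' (inner ℝ e q.1))
    (hb : HasDerivAt (axialCoeff k) b' (inner ℝ e q.1)) (u : TangentSpace (𝓡 n) q) :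
    mvfderiv (𝓡 n) (fun w : UnitSphere n => zonalNormal k e w) q u =
      radialCoeff k (inner ℝ e q.1) • mvfderiv (𝓡 n) (Subtype.val : UnitSphere n → _) q u +
        inner ℝ e (mvfderiv (𝓡 n) (Subtype.val : UnitSphere n → _) q u) • (a' • q.1 + b' • e) := by
  have h0 : HasFDerivAt (fun w => inner ℝ e w) (innerSL ℝ e) q.1 :=
    (innerSL ℝ e).hasFDerivAt
  have h1 := ((ha.comp_hasFDerivAt q.1 h0).smul (hasFDerivAt_id q.1)).add
    ((hb.comp_hasFDerivAt q.1 h0).smul_const e)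
  rw [mvfderiv_comp_coe_unitSphere (f := fun w => zonalNormal k e w) h1]
  simp
  module

end

/-! ### Embeddedness, mean curvature and outward normal of zonal graphs -/

section

variable {n : ℕ} {k : ℝ → ℝ} {c x : ℝ} {e v : EuclideanSpace ℝ (Fin (n + 1))}

theorem radialCoeff_add_mul_axialCoeff :
    radialCoeff k x + x * axialCoeff k x = k x / zonalSpeed k x := by
  simp only [radialCoeff, axialCoeff]
  ring

theorem sq_radialCoeff_add_sq_axialCoeff (hx : x ∈ Icc (-1 : ℝ) 1) (hpos : 0 < k x) :
    radialCoeff k x ^ 2 + 2 * (radialCoeff k x * axialCoeff k x * x) + axialCoeff k x ^ 2 = 1 := by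
  have hW := zonalSpeed_pos hx hpos
  have hWsq := zonalSpeed_sq hx hpos
  simp only [radialCoeff, axialCoeff]
  field_simp
  linear_combination -hWsq

theorem norm_zonalNormal (hpos : ∀ x ∈ Icc (-1 : ℝ) 1, 0 < k x) (he : ‖e‖ = 1)
    {w : EuclideanSpace ℝ (Fin (n + 1))} (hw : ‖w‖ = 1) : ‖zonalNormal k e w‖ = 1 := by
  have hx := inner_mem_Icc he hw
  rw [← pow_eq_one_iff_of_nonneg (norm_nonneg _) two_ne_zero, zonalNormal, norm_add_sq_real,
    norm_smul, norm_smul, he, hw, real_inner_smul_left, real_inner_smul_right,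
    real_inner_comm e w, mul_one, mul_one, Real.norm_eq_abs, Real.norm_eq_abs, sq_abs, sq_abs]
  rw [← sq_radialCoeff_add_sq_axialCoeff hx (hpos _ hx)]
  ring

theorem norm_zonalGraph_sub (hpos : ∀ x ∈ Icc (-1 : ℝ) 1, 0 < k x) (hc : 0 < c) (he : ‖e‖ = 1)
    {w : EuclideanSpace ℝ (Fin (n + 1))} (hw : ‖w‖ = 1) :
    ‖c • k (inner ℝ e w) • w‖ = c * k (inner ℝ e w) := by
  rw [norm_smul, norm_smul, hw, mul_one, Real.norm_of_nonneg hc.le,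
    Real.norm_of_nonneg (hpos _ (inner_mem_Icc he hw)).le]

theorem inner_mvfderiv_coe (q : UnitSphere n) (u : TangentSpace (𝓡 n) q) :
    inner ℝ q.1 (mvfderiv (𝓡 n)
      (Subtype.val : UnitSphere n → EuclideanSpace ℝ (Fin (n + 1))) q u) = 0 :=
  (inner_eq_zero_iff_exists_mvfderiv_coe q _).2 ⟨u, rfl⟩

/-- A point of the graph determines its radius, hence its direction. If the differential kills a
vector, pairing with `q` removes the radial part, and the rest is a positive multiple of the tangent
vector. -/
theorem isEmbeddedSphere_zonalGraph (hk : ContDiff ℝ 2 k) (hks : SmoothInCos k)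
    (hpos : ∀ x ∈ Icc (-1 : ℝ) 1, 0 < k x) (hc : 0 < c) (he : ‖e‖ = 1) :
    IsEmbeddedSphere fun w : UnitSphere n => zonalGraph k c e v w := by
  refine ⟨hks.contMDiff_zonalGraph he, fun w₁ w₂ h => ?_, fun q => ?_⟩
  · have h1 : c • k (inner ℝ e w₁.1) • w₁.1 = c • k (inner ℝ e w₂.1) • w₂.1 :=
      add_right_cancel h
    have h2 := congrArg norm h1
    rw [norm_zonalGraph_sub hpos hc he (by simp), norm_zonalGraph_sub hpos hc he (by simp)] at h2
    rw [smul_smul, smul_smul, h2] at h1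
    exact Subtype.ext (smul_right_injective _
      (mul_pos hc (hpos _ (inner_mem_Icc he (by simp)))).ne' h1)
  · refine (injective_iff_map_eq_zero _).2 fun u hu => ?_
    rw [mvfderiv_zonalGraph hk, smul_eq_zero_iff_right hc.ne'] at hu
    have h0 := inner_mvfderiv_coe q u
    have h1 := congrArg (inner ℝ q.1) hu
    rw [inner_add_right, real_inner_smul_right, h0, real_inner_smul_right,
      real_inner_self_eq_norm_sq, norm_eq_of_mem_sphere, inner_zero_right, mul_zero, zero_add,
      one_pow, mul_one] at h1
    rw [h1, zero_smul, add_zero,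
      smul_eq_zero_iff_right (hpos _ (inner_mem_Icc he (by simp))).ne'] at hu
    exact injective_mvfderiv_coe_unitSphere q (hu.trans (map_zero _).symm)

theorem inner_zonalNormal_mvfderiv (hk : ContDiff ℝ 2 k) (q : UnitSphere n)
    (u : TangentSpace (𝓡 n) q) :
    inner ℝ (zonalNormal k e q.1)
      (mvfderiv (𝓡 n) (fun w : UnitSphere n => zonalGraph k c e v w) q u) = 0 := by
  rw [mvfderiv_zonalGraph hk, zonalNormal]
  have h0 := inner_mvfderiv_coe q u
  generalize mvfderiv (𝓡 n) (Subtype.val : UnitSphere n → _) q u = u' at *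
  simp only [inner_add_left, inner_add_right, real_inner_smul_left, real_inner_smul_right, h0,
    real_inner_self_eq_norm_sq, norm_eq_of_mem_sphere]
  simp only [radialCoeff, axialCoeff]
  ring

/-- Let `a`, `b` be the coefficients of `w` and `e` in the normal and `ξ` the tangential part of
`e`. The shape operator is `c⁻¹ (a/k · id + b'/k · ⟨e, ·⟩ ξ)`, and `⟨e, ξ⟩ = 1 - x²`. So the trace
counts `a/k` for `n - 1` directions and the meridian curvature `a/k + (1 - x²) b'/k` once. -/
theorem hasMeanCurvatureAt_zonalGraph (hn : 1 ≤ n) (hk : ContDiff ℝ 2 k)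
    (hpos : ∀ x ∈ Icc (-1 : ℝ) 1, 0 < k x) (hc : 0 < c) (he : ‖e‖ = 1) (q : UnitSphere n) :
    HasMeanCurvatureAt (fun w : UnitSphere n => zonalGraph k c e v w)
      (fun w : UnitSphere n => zonalNormal k e w) q
      (c⁻¹ * zonalMeanCurvature n k (inner ℝ e q.1)) := by
  have hx := inner_mem_Icc he (norm_eq_of_mem_sphere q)
  have hK := hpos _ hx
  obtain ⟨a', b', ha, hb, h1, h2⟩ := exists_hasDerivAt_coeff hk hx hK
  have hxq : inner ℝ e q.1 = inner ℝ q.1 e := real_inner_comm _ _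
  obtain ⟨ξ, hξ⟩ := (inner_eq_zero_iff_exists_mvfderiv_coe q (e - inner ℝ e q.1 • q.1)).1 (by
    rw [inner_sub_right, real_inner_smul_right, real_inner_self_eq_norm_sq,
      norm_eq_of_mem_sphere, hxq]
    ring)
  have hξe : inner ℝ e (mvfderiv (𝓡 n) (Subtype.val : UnitSphere n → _) q ξ) =
      1 - inner ℝ e q.1 ^ 2 := by
    rw [hξ, inner_sub_right, real_inner_smul_right, real_inner_self_eq_norm_sq, he]
    ring
  let ℓ : TangentSpace (𝓡 n) q →ₗ[ℝ] ℝ :=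
    ((innerSL ℝ e) ∘L mvfderiv (𝓡 n) (Subtype.val : UnitSphere n → _) q).toLinearMap
  have hℓ : ∀ u, ℓ u = inner ℝ e (mvfderiv (𝓡 n) (Subtype.val : UnitSphere n → _) q u) :=
    fun u => rfl
  refine ⟨c⁻¹ • ((radialCoeff k (inner ℝ e q.1) / k (inner ℝ e q.1)) • LinearMap.id +
    (b' / k (inner ℝ e q.1)) • ℓ.smulRight ξ), fun u => ?_, ?_⟩
  · rw [mvfderiv_zonalNormal ha hb, mvfderiv_zonalGraph hk]
    simp only [LinearMap.smul_apply, LinearMap.add_apply, LinearMap.id_apply,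
      LinearMap.smulRight_apply, map_smul, map_add, hξ, inner_add_right, real_inner_smul_right,
      hℓ]
    rw [← hξ, hξe, hξ]
    generalize mvfderiv (𝓡 n) (Subtype.val : UnitSphere n → _) q u = u' at *
    generalize inner ℝ e q.1 = x at *
    -- Orthogonality of the normal to the graph determines `a'` from `b'`; after this substitution
    -- the coefficients of `u'`, `q` and `e` can be compared separately.
    have ha' : a' = deriv k x * (radialCoeff k x + (1 - x ^ 2) * b') / k x - x * b' := by
      field_simp
      linear_combination h1
    rw [ha']
    match_scalars
    · field_simp
    · field_simp
      ring
    · field_simp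
  · have : Module.Finite ℝ (TangentSpace (𝓡 n) q) :=
      inferInstanceAs (Module.Finite ℝ (EuclideanSpace ℝ (Fin n)))
    rw [map_smul, map_add, map_smul, map_smul, LinearMap.trace_id, LinearMap.trace_smulRight, hℓ,
      hξe]
    have hfr : Module.finrank ℝ (TangentSpace (𝓡 n) q) = n := finrank_euclideanSpace_fin
    rw [hfr]
    have hn' : (n : ℝ) ≠ 0 := by positivity
    simp only [zonalMeanCurvature, smul_eq_mul]
    rw [← h2]
    have : (k (inner ℝ e q.1) + inner ℝ e q.1 * deriv k (inner ℝ e q.1)) /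
      (k (inner ℝ e q.1) * zonalSpeed k (inner ℝ e q.1)) =
      radialCoeff k (inner ℝ e q.1) / k (inner ℝ e q.1) := by
      rw [radialCoeff, div_div, mul_comm (k _)]
    rw [this]
    ring

/-- The graph is star-shaped about `v`: the ray from `y + v` away from `v` never meets it again, so
it is an unbounded connected subset of the complement. -/
theorem not_isBounded_connectedComponentIn_compl_zonalGraph
    (hpos : ∀ x ∈ Icc (-1 : ℝ) 1, 0 < k x) (hc : 0 < c) (he : ‖e‖ = 1)
    {y : EuclideanSpace ℝ (Fin (n + 1))} (hy0 : y ≠ 0)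
    (hy : c * k (inner ℝ e y / ‖y‖) < ‖y‖) :
    ¬ Bornology.IsBounded (connectedComponentIn
      (range fun w : UnitSphere n => zonalGraph k c e v w)ᶜ (y + v)) := by
  have hy' := norm_pos_iff.2 hy0
  have hcont : Continuous fun l : ℝ => l • y + v := by fun_prop
  have hray : (fun l : ℝ => l • y + v) '' Ici 1 ⊆ connectedComponentIn
      (range fun w : UnitSphere n => zonalGraph k c e v w)ᶜ (y + v) := by
    refine (isPreconnected_Ici.image _ hcont.continuousOn).subset_connectedComponentIn
      ⟨1, self_mem_Ici, by simp⟩ ?_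
    rintro _ ⟨l, hl, rfl⟩ ⟨w, hw⟩
    have hl' : (0 : ℝ) < l := zero_lt_one.trans_le hl
    have h1 : c • k (inner ℝ e w.1) • w.1 = l • y := add_right_cancel hw
    have h2 := congrArg norm h1
    rw [norm_zonalGraph_sub hpos hc he (by simp), norm_smul, Real.norm_of_nonneg hl'.le] at h2
    have h3 : w.1 = ‖y‖⁻¹ • y := by
      rw [smul_smul, h2, ← smul_smul] at h1
      have := smul_right_injective _ hl'.ne' h1
      exact (inv_smul_eq_iff₀ hy'.ne').2 this.symm |>.symm
    rw [h3, real_inner_smul_right, inv_mul_eq_div] at h2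
    rw [h2] at hy
    have : (1 : ℝ) ≤ l := hl
    nlinarith
  intro hb
  obtain ⟨C, hC⟩ := (hb.subset hray).exists_norm_le
  have h1 := hC _ ⟨max 1 ((C + ‖v‖ + 1) / ‖y‖), mem_Ici.2 (le_max_left _ _), rfl⟩
  have h2 : C + ‖v‖ + 1 ≤ ‖max 1 ((C + ‖v‖ + 1) / ‖y‖) • y‖ := by
    rw [norm_smul, Real.norm_of_nonneg (zero_le_one.trans (le_max_left _ _)), ← div_le_iff₀ hy']
    exact le_max_right _ _
  have h3 := norm_sub_le (max 1 ((C + ‖v‖ + 1) / ‖y‖) • y + v) v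
  rw [add_sub_cancel_right] at h3
  linarith

/-- The difference of the two sides vanishes at `t = 0`, and moving along the normal makes it grow
at first order, at rate `W / k` with `W` the `zonalSpeed`. -/
theorem eventually_lt_norm_add_smul_zonalNormal (hk : ContDiff ℝ 2 k)
    (hpos : ∀ x ∈ Icc (-1 : ℝ) 1, 0 < k x) (hc : 0 < c) (he : ‖e‖ = 1)
    {w : EuclideanSpace ℝ (Fin (n + 1))} (hw : ‖w‖ = 1) :
    ∀ᶠ t : ℝ in 𝓝[>] 0,
      c * k (inner ℝ e (c • k (inner ℝ e w) • w + t • zonalNormal k e w) /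
        ‖c • k (inner ℝ e w) • w + t • zonalNormal k e w‖) <
        ‖c • k (inner ℝ e w) • w + t • zonalNormal k e w‖ := by
  have hx := inner_mem_Icc he hw
  have hK := hpos _ hx
  have hwe : inner ℝ w e = inner ℝ e w := real_inner_comm _ _
  have hN := norm_zonalNormal hpos he hw
  have hnorm : ∀ t : ℝ, ‖c • k (inner ℝ e w) • w + t • zonalNormal k e w‖ =
      √((c * k (inner ℝ e w)) ^ 2 + 2 * t * (c * k (inner ℝ e w)) *
        (k (inner ℝ e w) / zonalSpeed k (inner ℝ e w)) + t ^ 2) := fun t => by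
    rw [← Real.sqrt_sq (norm_nonneg (_ + _)), norm_add_sq_real, norm_zonalGraph_sub hpos hc he hw,
      norm_smul, hN, mul_one, Real.norm_eq_abs, sq_abs, ← radialCoeff_add_mul_axialCoeff]
    congr 1
    simp only [zonalNormal, real_inner_smul_left, real_inner_smul_right, inner_add_right,
      real_inner_self_eq_norm_sq, hw, hwe]
    ring
  have hinner : ∀ t : ℝ, inner ℝ e (c • k (inner ℝ e w) • w + t • zonalNormal k e w) =
      c * k (inner ℝ e w) * inner ℝ e w + t * (radialCoeff k (inner ℝ e w) * inner ℝ e w +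
        axialCoeff k (inner ℝ e w)) := fun t => by
    simp only [zonalNormal, real_inner_smul_right, inner_add_right,
      real_inner_self_eq_norm_sq, he]
    ring
  simp only [hnorm, hinner]
  generalize inner ℝ e w = x at *
  have hW := zonalSpeed_pos hx hK
  have hρ : 0 < c * k x := mul_pos hc hK
  have hR0 : √((c * k x) ^ 2 + 2 * 0 * (c * k x) * (k x / zonalSpeed k x) + 0 ^ 2) = c * k x := by
    rw [show (c * k x) ^ 2 + 2 * 0 * (c * k x) * (k x / zonalSpeed k x) + 0 ^ 2
      = (c * k x) ^ 2 by ring, Real.sqrt_sq hρ.le]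
  have hR : HasDerivAt (fun t : ℝ => √((c * k x) ^ 2 + 2 * t * (c * k x) *
      (k x / zonalSpeed k x) + t ^ 2)) (k x / zonalSpeed k x) 0 := by
    have h1 : HasDerivAt (fun t : ℝ => (c * k x) ^ 2 + 2 * t * (c * k x) *
      (k x / zonalSpeed k x) + t ^ 2) (2 * (c * k x) * (k x / zonalSpeed k x)) 0 := by
      have := ((((hasDerivAt_id' (0 : ℝ)).const_mul 2).mul_const (c * k x)).mul_const
        (k x / zonalSpeed k x)).const_add ((c * k x) ^ 2) |>.add ((hasDerivAt_id' (0 : ℝ)).pow 2)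
      convert! this using 1
      simp
    convert! h1.sqrt (by simpa using hρ.ne') using 1
    rw [hR0]
    field_simp
  have hI : HasDerivAt (fun t : ℝ => c * k x * x + t * (radialCoeff k x * x + axialCoeff k x))
      (radialCoeff k x * x + axialCoeff k x) 0 := by
    simpa using ((hasDerivAt_id' (0 : ℝ)).mul_const
      (radialCoeff k x * x + axialCoeff k x)).const_add (c * k x * x)
  have hQ := hI.div hR (by rw [hR0]; exact hρ.ne')
  have hx0 : ((fun t : ℝ => c * k x * x + t * (radialCoeff k x * x + axialCoeff k x)) /
      (fun t : ℝ => √((c * k x) ^ 2 + 2 * t * (c * k x) * (k x / zonalSpeed k x) + t ^ 2))) 0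
      = x := by
    simp only [Pi.div_apply, hR0]
    field_simp
    ring
  have hkd : HasDerivAt k (deriv k x) (((fun t : ℝ => c * k x * x + t *
      (radialCoeff k x * x + axialCoeff k x)) / (fun t : ℝ => √((c * k x) ^ 2 +
        2 * t * (c * k x) * (k x / zonalSpeed k x) + t ^ 2))) 0) := by
    rw [hx0]
    exact (hk.differentiable (by simp) x).hasDerivAt
  have hF := hR.sub ((hkd.comp 0 hQ).const_mul c)
  have hlim := hF.tendsto_slope_zero_right
  -- This is the derivative at `0` of norm minus graph radius: the first term is the growth of the
  -- norm, the second comes from the change of the angle.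
  have hposD : 0 < k x / zonalSpeed k x + (1 - x ^ 2) * deriv k x ^ 2 / (k x * zonalSpeed k x) := by
    have : 0 ≤ 1 - x ^ 2 := by nlinarith [hx.1, hx.2]
    positivity
  have hev := hlim.eventually_const_lt (u := 0) (by
    refine hposD.trans_eq ?_
    simp only [hR0]
    simp only [radialCoeff, axialCoeff]
    field_simp
    ring)
  filter_upwards [hev, self_mem_nhdsWithin] with t ht ht0
  have h0 : (0 : ℝ) < t := ht0
  simp only [zero_add, Pi.sub_apply, Pi.div_apply, comp_apply, smul_eq_mul] at ht
  have h1 := pos_of_mul_pos_right ht (inv_pos.2 h0).le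
  simp only [hR0] at h1
  have h2 : (c * k x * x + 0 * (radialCoeff k x * x + axialCoeff k x)) / (c * k x) = x := by
    field_simp
    ring
  rw [h2] at h1
  linarith

theorem isOutwardUnitNormal_zonalNormal (hk : ContDiff ℝ 2 k) (hks : SmoothInCos k)
    (hks' : SmoothInCos (deriv k)) (hpos : ∀ x ∈ Icc (-1 : ℝ) 1, 0 < k x) (hc : 0 < c)
    (he : ‖e‖ = 1) :
    IsOutwardUnitNormal (fun w : UnitSphere n => zonalGraph k c e v w)
      fun w : UnitSphere n => zonalNormal k e w := by
  refine ⟨hks.contMDiff_zonalNormal hks' hpos he, fun q => norm_zonalNormal hpos he (by simp),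
    fun q u => inner_zonalNormal_mvfderiv hk q u, fun q => ?_⟩
  have hq : c • k (inner ℝ e q.1) • q.1 ≠ 0 := by
    rw [← norm_pos_iff, norm_zonalGraph_sub hpos hc he (by simp)]
    exact mul_pos hc (hpos _ (inner_mem_Icc he (by simp)))
  have hne : ∀ᶠ t : ℝ in 𝓝[>] 0, c • k (inner ℝ e q.1) • q.1 + t • zonalNormal k e q.1 ≠ 0 := by
    have hcont : Continuous fun t : ℝ => c • k (inner ℝ e q.1) • q.1 + t • zonalNormal k e q.1 := by
      fun_prop
    exact (hcont.continuousAt.eventually_ne (x := 0) (by simpa using hq)).filter_mono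
      nhdsWithin_le_nhds
  filter_upwards [eventually_lt_norm_add_smul_zonalNormal hk hpos hc he
    (norm_eq_of_mem_sphere q), hne] with t ht ht'
  rw [zonalGraph, add_right_comm]
  exact not_isBounded_connectedComponentIn_compl_zonalGraph hpos hc he ht' ht

theorem isBubble_zonalGraph (hn : 1 ≤ n) (hk : ContDiff ℝ 2 k) (hks : SmoothInCos k)
    (hks' : SmoothInCos (deriv k)) (hpos : ∀ x ∈ Icc (-1 : ℝ) 1, 0 < k x) (hc : 0 < c)
    (he : ‖e‖ = 1) {H : EuclideanSpace ℝ (Fin (n + 1)) → ℝ}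
    (hH : ∀ q : UnitSphere n,
      H (zonalGraph k c e v q) = c⁻¹ * zonalMeanCurvature n k (inner ℝ e q.1)) :
    IsBubble H (range fun w : UnitSphere n => zonalGraph k c e v w) := by
  refine ⟨_, _, rfl, isEmbeddedSphere_zonalGraph hk hks hpos hc he,
    isOutwardUnitNormal_zonalNormal hk hks hks' hpos hc he, fun q => ?_⟩
  rw [hH]
  exact hasMeanCurvatureAt_zonalGraph hn hk hpos hc he q

end

/-! ### From angle to cosine; the mean curvature at the pole -/

section

variable {k : ℝ → ℝ}

theorem hasDerivAt_comp_cos {t : ℝ} (hk : DifferentiableAt ℝ k (Real.cos t)) :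
    HasDerivAt (fun t => k (Real.cos t)) (-(Real.sin t * deriv k (Real.cos t))) t := by
  convert! hk.hasDerivAt.comp t (Real.hasDerivAt_cos t) using 1
  ring

theorem ContDiff.deriv_of_succ {N : ℕ∞ω} (hk : ContDiff ℝ (N + 1) k) : ContDiff ℝ N (deriv k) :=
  (contDiff_succ_iff_deriv.1 hk).2.2

theorem deriv_deriv_comp_cos (hk : ContDiff ℝ 2 k) :
    deriv (deriv fun t => k (Real.cos t)) = fun t =>
      -(Real.cos t * deriv k (Real.cos t)) + Real.sin t ^ 2 * deriv (deriv k) (Real.cos t) := by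
  have hk' : ContDiff ℝ 1 (deriv k) :=
    ContDiff.deriv_of_succ (by simpa [one_add_one_eq_two] using hk)
  have h1 : (deriv fun t => k (Real.cos t)) = fun t => -(Real.sin t * deriv k (Real.cos t)) :=
    funext fun t => (hasDerivAt_comp_cos (hk.differentiable (by simp) _)).deriv
  rw [h1]
  funext t
  have := ((Real.hasDerivAt_sin t).mul
    (hasDerivAt_comp_cos (t := t) (hk'.differentiable (by simp) _))).neg
  convert! this.deriv using 1
  ring

/-- The two expressions of the mean curvature of a hypersurface of revolution, in terms of the
polar angle and of its cosine. -/
theorem revolutionMeanCurvature_comp_cos (n : ℕ) (hk : ContDiff ℝ 2 k) {t : ℝ}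
    (hpos : 0 < k (Real.cos t)) :
    revolutionMeanCurvature n (fun t => k (Real.cos t)) t =
      zonalMeanCurvature n k (Real.cos t) := by
  have hx := cos_mem_Icc_neg_one_one t
  have hd := (hasDerivAt_comp_cos (t := t) (hk.differentiable (by simp) _)).deriv
  have hdd := congrFun (deriv_deriv_comp_cos hk) t
  have hs : 1 - Real.cos t ^ 2 = Real.sin t ^ 2 := by rw [Real.sin_sq]
  have hrad : k (Real.cos t) ^ 2 + deriv (fun t => k (Real.cos t)) t ^ 2 =
      k (Real.cos t) ^ 2 + (1 - Real.cos t ^ 2) * deriv k (Real.cos t) ^ 2 := by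
    rw [hd, hs]
    ring
  have hW : √(k (Real.cos t) ^ 2 + deriv (fun t => k (Real.cos t)) t ^ 2) =
      zonalSpeed k (Real.cos t) := by rw [hrad, zonalSpeed]
  have hW3 : (k (Real.cos t) ^ 2 + deriv (fun t => k (Real.cos t)) t ^ 2) ^ (3 / 2 : ℝ) =
      zonalSpeed k (Real.cos t) ^ 3 := by
    rw [hrad, zonalSpeed, Real.sqrt_eq_rpow,
      ← Real.rpow_mul_natCast (zonalSpeed_radicand_pos hx hpos).le]
    norm_num
  have h1 : parallelCurvature (fun t => k (Real.cos t)) t =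
      (k (Real.cos t) + Real.cos t * deriv k (Real.cos t)) /
        (k (Real.cos t) * zonalSpeed k (Real.cos t)) := by
    rw [parallelCurvature]
    -- Where `sin` vanishes, the second derivative of `k ∘ cos` is `-cos · k'`, so the value by
    -- continuity is given by the same expression.
    split_ifs with h0
    · rw [hW, hdd, h0]
      congr 1
      ring
    · rw [hW, hd]
      congr 1
      field_simp
      ring
  have h2 : meridianCurvature (fun t => k (Real.cos t)) t = (k (Real.cos t) ^ 2
      + 2 * (1 - Real.cos t ^ 2) * deriv k (Real.cos t) ^ 2
      + Real.cos t * k (Real.cos t) * deriv k (Real.cos t)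
      - (1 - Real.cos t ^ 2) * k (Real.cos t) * deriv (deriv k) (Real.cos t)) /
        zonalSpeed k (Real.cos t) ^ 3 := by
    rw [meridianCurvature, hW3, hd, hdd, hs]
    congr 1
    ring
  rw [revolutionMeanCurvature, h1, h2, zonalMeanCurvature]

theorem iteratedDeriv_two_comp_cos_zero (hk : ContDiff ℝ 2 k) :
    iteratedDeriv 2 (fun t => k (Real.cos t)) 0 = -deriv k 1 := by
  rw [iteratedDeriv_succ, iteratedDeriv_one, deriv_deriv_comp_cos hk]
  simp

/-- With the formula for the second derivative, this turns `h''(0) = h''''(0) = 0` into `k'(1) =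
k''(1) = 0`. -/
theorem iteratedDeriv_four_comp_cos_zero (hk : ContDiff ℝ 4 k) :
    iteratedDeriv 4 (fun t => k (Real.cos t)) 0 = deriv k 1 + 3 * deriv (deriv k) 1 := by
  have hk1 : ContDiff ℝ 3 (deriv k) := ContDiff.deriv_of_succ (by exact_mod_cast hk)
  have hk2 : ContDiff ℝ 2 (deriv (deriv k)) := ContDiff.deriv_of_succ (by exact_mod_cast hk1)
  have hk3 : ContDiff ℝ 1 (deriv (deriv (deriv k))) :=
    ContDiff.deriv_of_succ (by exact_mod_cast hk2)
  have c1 := fun t => hasDerivAt_comp_cos (t := t) (hk1.differentiable (by simp) _)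
  have c2 := fun t => hasDerivAt_comp_cos (t := t) (hk2.differentiable (by simp) _)
  have c3 := fun t => hasDerivAt_comp_cos (t := t) (hk3.differentiable (by simp) _)
  have h3 : deriv (deriv (deriv fun t => k (Real.cos t))) = fun t =>
      Real.sin t * deriv k (Real.cos t) +
        3 * (Real.sin t * Real.cos t * deriv (deriv k) (Real.cos t)) -
        Real.sin t ^ 3 * deriv (deriv (deriv k)) (Real.cos t) := by
    rw [deriv_deriv_comp_cos (hk.of_le (by norm_num))]
    funext t
    have := ((Real.hasDerivAt_cos t).mul (c1 t)).neg.add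
      (((Real.hasDerivAt_sin t).pow 2).mul (c2 t))
    convert! this.deriv using 1
    simp only [Pi.pow_apply]
    push_cast
    ring
  rw [iteratedDeriv_succ, iteratedDeriv_succ, iteratedDeriv_succ, iteratedDeriv_one, h3]
  have := (((Real.hasDerivAt_sin 0).mul (c1 0)).add
    ((((Real.hasDerivAt_sin 0).mul (Real.hasDerivAt_cos 0)).mul (c2 0)).const_mul 3)).sub
    (((Real.hasDerivAt_sin 0).pow 3).mul (c3 0))
  convert! this.deriv using 1
  simp

theorem zonalMeanCurvature_const_one {n : ℕ} (hn : 1 ≤ n) (x : ℝ) :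
    zonalMeanCurvature n (fun _ => 1) x = 1 := by
  have : (n : ℝ) ≠ 0 := by positivity
  simp [zonalMeanCurvature, zonalSpeed, this]

/-- This is why `H_ε` carries the factor `g_ε(0)`: the value at the far pole matches the constant
outside the ball. -/
theorem zonalMeanCurvature_one {n : ℕ} (hn : 1 ≤ n) (hpos : 0 < k 1) (h1 : deriv k 1 = 0) :
    k 1 * zonalMeanCurvature n k 1 = 1 := by
  have : (n : ℝ) ≠ 0 := by positivity
  have hW : zonalSpeed k 1 = k 1 := by simp [zonalSpeed, Real.sqrt_sq hpos.le]
  rw [zonalMeanCurvature, hW, h1]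
  field_simp
  ring

/-- Independent functions `p`, `q`, `r`, `y` on a normed space let one statement serve both for
regularity in `x` and for joint regularity in `(ε, x)`. -/
theorem contDiffAt_zonalMeanCurvature_expr (n : ℕ) {E : Type*} [NormedAddCommGroup E]
    [NormedSpace ℝ E] {N : ℕ∞ω} {p q r y : E → ℝ} {z : E} (hp : ContDiffAt ℝ N p z)
    (hq : ContDiffAt ℝ N q z) (hr : ContDiffAt ℝ N r z) (hy : ContDiffAt ℝ N y z)
    (hyz : y z ∈ Icc (-1 : ℝ) 1) (hpz : 0 < p z) :
    ContDiffAt ℝ N (fun z => (((n : ℝ) - 1) * ((p z + y z * q z) /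
      (p z * √(p z ^ 2 + (1 - y z ^ 2) * q z ^ 2))) +
      (p z ^ 2 + 2 * (1 - y z ^ 2) * q z ^ 2 + y z * p z * q z
      - (1 - y z ^ 2) * p z * r z) / √(p z ^ 2 + (1 - y z ^ 2) * q z ^ 2) ^ 3) / n) z := by
  have hrad : 0 < p z ^ 2 + (1 - y z ^ 2) * q z ^ 2 := by
    have : 0 ≤ 1 - y z ^ 2 := by nlinarith [hyz.1, hyz.2]
    positivity
  have hW : ContDiffAt ℝ N (fun z => √(p z ^ 2 + (1 - y z ^ 2) * q z ^ 2)) z :=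
    ((hp.pow 2).add ((contDiffAt_const.sub (hy.pow 2)).mul (hq.pow 2))).sqrt hrad.ne'
  have hW0 : √(p z ^ 2 + (1 - y z ^ 2) * q z ^ 2) ≠ 0 := (Real.sqrt_pos.2 hrad).ne'
  refine ((contDiffAt_const.mul ((hp.add (hy.mul hq)).div (hp.mul hW)
    (mul_ne_zero hpz.ne' hW0))).add (ContDiffAt.div ?_ (hW.pow 3) (pow_ne_zero 3 hW0))).div_const _
  exact (((hp.pow 2).add ((contDiffAt_const.mul (contDiffAt_const.sub (hy.pow 2))).mul
    (hq.pow 2))).add ((hy.mul hp).mul hq)).sub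
      (((contDiffAt_const.sub (hy.pow 2)).mul hp).mul hr)

theorem contDiffAt_zonalMeanCurvature (n : ℕ) {N : ℕ∞ω} {x : ℝ} (hk : ContDiffAt ℝ N k x)
    (hk' : ContDiffAt ℝ N (deriv k) x) (hk'' : ContDiffAt ℝ N (deriv (deriv k)) x)
    (hx : x ∈ Icc (-1 : ℝ) 1) (hpos : 0 < k x) : ContDiffAt ℝ N (zonalMeanCurvature n k) x :=
  contDiffAt_zonalMeanCurvature_expr n hk hk' hk'' contDiffAt_id hx hpos

/-- The third derivative of `k` enters only with the factor `1 - x²`, which is zero at `x = 1`;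
every other term contains `k'(1)` or `k''(1)`. -/
theorem deriv_zonalMeanCurvature_one (n : ℕ) (hk : ContDiff ℝ 3 k) (hpos : 0 < k 1)
    (h1 : deriv k 1 = 0) (h2 : deriv (deriv k) 1 = 0) :
    deriv (zonalMeanCurvature n k) 1 = 0 := by
  have hk1 : ContDiff ℝ 2 (deriv k) := ContDiff.deriv_of_succ (by exact_mod_cast hk)
  have hk2 : ContDiff ℝ 1 (deriv (deriv k)) := ContDiff.deriv_of_succ (by exact_mod_cast hk1)
  have d0 : HasDerivAt k 0 1 := h1 ▸ (hk.differentiable (by simp) 1).hasDerivAt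
  have d1 : HasDerivAt (deriv k) 0 1 := h2 ▸ (hk1.differentiable (by simp) 1).hasDerivAt
  have d2 := (hk2.differentiable (by simp) 1).hasDerivAt
  have hx : (1 : ℝ) ∈ Icc (-1 : ℝ) 1 := by simp
  have dW : HasDerivAt (zonalSpeed k) 0 1 := by
    simpa [h1] using hasDerivAt_zonalSpeed (hk.of_le (by norm_num)) hx hpos
  have hW := zonalSpeed_pos hx hpos
  have dy : HasDerivAt (fun x : ℝ => 1 - x ^ 2) (-2) 1 := by
    simpa using ((hasDerivAt_id' (1 : ℝ)).pow 2).const_sub 1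
  have D1 : HasDerivAt (fun x => k x + x * deriv k x) 0 1 := by
    convert! d0.add ((hasDerivAt_id' (1 : ℝ)).mul d1) using 1
    simp [h1]
  have D2 : HasDerivAt (fun x => k x ^ 2 + 2 * (1 - x ^ 2) * deriv k x ^ 2 + x * k x * deriv k x
      - (1 - x ^ 2) * k x * deriv (deriv k) x) 0 1 := by
    have := (((d0.pow 2).add ((dy.const_mul 2).mul (d1.pow 2))).add
      (((hasDerivAt_id' (1 : ℝ)).mul d0).mul d1)).sub ((dy.mul d0).mul d2)
    convert! this using 1
    simp [h1, h2]
  have D := (((D1.div (d0.mul dW) (mul_pos hpos hW).ne').const_mul ((n : ℝ) - 1)).add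
    (D2.div (dW.pow 3) (pow_pos hW 3).ne')).div_const (n : ℝ)
  convert! D.deriv using 1
  simp

end

/-! ### Inverting the distance function and factoring through it -/

section

variable {F m F' m' : ℝ → ℝ}

/-- The inverse of `F` is precomposed with the projection onto `[F a, F b]`. The result is monotone
and onto `[a, b]`, hence continuous. -/
theorem exists_continuous_clamped_inverse {F : ℝ → ℝ} {a b : ℝ} (hab : a < b)
    (hF : ContinuousOn F (Icc a b)) (hmono : StrictMonoOn F (Icc a b)) :
    ∃ X : ℝ → ℝ, Continuous X ∧ (∀ s, X s ∈ Icc a b) ∧ (∀ x ∈ Icc a b, X (F x) = x) ∧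
      (∀ s ∈ Icc (F a) (F b), F (X s) = s) ∧ ∀ s, F b ≤ s → X s = b := by
  have ha : a ∈ Icc a b := left_mem_Icc.2 hab.le
  have hb : b ∈ Icc a b := right_mem_Icc.2 hab.le
  have hFab : F a ≤ F b := (hmono ha hb hab).le
  have hex : ∀ s : ℝ, ∃ x : Icc a b, F x = projIcc (F a) (F b) hFab s := fun s => by
    obtain ⟨x, hx, hxs⟩ := intermediate_value_Icc hab.le hF (projIcc (F a) (F b) hFab s).2
    exact ⟨⟨x, hx⟩, hxs⟩
  choose Y hY using hex
  have hYF : ∀ x (hx : x ∈ Icc a b), Y (F x) = ⟨x, hx⟩ := fun x hx => by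
    refine Subtype.ext (hmono.injOn (Y _).2 hx ?_)
    rw [hY, projIcc_of_mem hFab ⟨hmono.monotoneOn ha hx hx.1, hmono.monotoneOn hx hb hx.2⟩]
  have hYmono : Monotone Y := fun s t hst => by
    rw [← Subtype.coe_le_coe, ← hmono.le_iff_le (Y s).2 (Y t).2, hY, hY]
    exact monotone_projIcc hFab hst
  have hYc : Continuous Y := hYmono.continuous_of_surjective fun x => ⟨F x, hYF x x.2⟩
  refine ⟨fun s => Y s, continuous_subtype_val.comp hYc, fun s => (Y s).2,
    fun x hx => by simp only [hYF x hx], fun s hs => by rw [hY, projIcc_of_mem hFab hs],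
    fun s hs => ?_⟩
  refine hmono.injOn (Y s).2 hb ?_
  rw [hY, projIcc_of_right_le hFab hs]

/-- A `C^1` function on an interval is a `C^1` function of any function with positive derivative;
it can be extended to the line by a constant if its derivative vanishes at the right end. -/
theorem exists_factorization {a b : ℝ} (hab : a < b) (hF : ∀ x ∈ Icc a b, HasDerivAt F (F' x) x)
    (hm : ∀ x ∈ Icc a b, HasDerivAt m (m' x) x) (hF' : ContinuousOn F' (Icc a b))
    (hm' : ContinuousOn m' (Icc a b)) (hpos : ∀ x ∈ Icc a b, 0 < F' x) (hb : m' b = 0) :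
    ∃ X G : ℝ → ℝ, Continuous X ∧ (∀ s, X s ∈ Icc a b) ∧ (∀ x ∈ Icc a b, X (F x) = x) ∧
      (∀ s ∈ Icc (F a) (F b), F (X s) = s) ∧ (∀ s, F b ≤ s → X s = b) ∧
      (∀ s, F a ≤ s → G s = m (X s)) ∧ Continuous (fun s => m' (X s) / F' (X s)) ∧
      ∀ s, HasDerivAt G (m' (X s) / F' (X s)) s := by
  have hFc : ContinuousOn F (Icc a b) := fun x hx => (hF x hx).continuousAt.continuousWithinAt
  have hmc : ContinuousOn m (Icc a b) := fun x hx => (hm x hx).continuousAt.continuousWithinAt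
  have hmono : StrictMonoOn F (Icc a b) := by
    refine strictMonoOn_of_deriv_pos (convex_Icc a b) hFc fun x hx => ?_
    rw [(hF x (interior_subset hx)).deriv]
    exact hpos x (interior_subset hx)
  obtain ⟨X, hXc, hX, hXF, hFX, hXb⟩ := exists_continuous_clamped_inverse hab hFc hmono
  have hc : Continuous fun s => m' (X s) / F' (X s) :=
    (hm'.comp_continuous hXc hX).div (hF'.comp_continuous hXc hX) fun s => (hpos _ (hX s)).ne'
  -- Defining `G` as an integral, not as `m ∘ X`, makes it differentiable on the whole line,
  -- including at both endpoints of `[F a, F b]`.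
  have hG : ∀ s, HasDerivAt (fun s => m a + ∫ y in (F a)..s, m' (X y) / F' (X y))
      (m' (X s) / F' (X s)) s := fun s =>
    (hc.integral_hasStrictDerivAt (F a) s).hasDerivAt.const_add (m a)
  generalize hGdef : (fun s => m a + ∫ y in (F a)..s, m' (X y) / F' (X y)) = G at hG
  have hGa : G (F a) = m a := by simp [← hGdef]
  have hGF : ∀ x ∈ Icc a b, G (F x) = m x := by
    have hd : ∀ x ∈ Icc a b, HasDerivAt (fun x => G (F x) - m x) 0 x := fun x hx => by
      have := ((hG (F x)).comp x (hF x hx)).sub (hm x hx)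
      rw [hXF x hx, div_mul_cancel₀ _ (hpos x hx).ne', sub_self] at this
      exact this
    intro x hx
    have := constant_of_has_deriv_right_zero
      (fun x hx => (hd x hx).continuousAt.continuousWithinAt)
      (fun x hx => (hd x (Ico_subset_Icc_self hx)).hasDerivWithinAt) x hx
    simp only [hGa, sub_self] at this
    linarith
  refine ⟨X, G, hXc, hX, hXF, hFX, hXb, fun s hs => ?_, hc, hG⟩
  rcases le_total s (F b) with h | h
  · rw [← hGF _ (hX s), hFX s ⟨hs, h⟩]
  -- Beyond `F b` the integrand is `m' b / F' b = 0`, so `G` stays constant.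
  · rw [hXb s h, ← hGF b (right_mem_Icc.2 hab.le)]
    refine constant_of_has_deriv_right_zero (a := F b) (b := s)
      (fun x _ => (hG x).continuousAt.continuousWithinAt) (fun x hx => ?_) s ⟨h, le_rfl⟩
    have := (hG x).hasDerivWithinAt (s := Ici x)
    rwa [hXb x hx.1, hb, zero_div] at this

/-- A continuous right inverse stays in the domain where `F` is injective, so it coincides with the
local inverse of the inverse function theorem. -/
theorem contDiffAt_of_rightInverse {X : ℝ → ℝ} {N : ℕ∞ω} {s c : ℝ} (hN : N ≠ 0)
    (hX : ContinuousAt X s) (hF : ContDiffAt ℝ N F (X s)) (hF' : HasDerivAt F c (X s))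
    (hc : c ≠ 0) (hFX : ∀ᶠ s in 𝓝 s, F (X s) = s) : ContDiffAt ℝ N X s := by
  have hfd : HasFDerivAt F ((ContinuousLinearEquiv.unitsEquivAut ℝ (Units.mk0 c hc) :
      ℝ ≃L[ℝ] ℝ) : ℝ →L[ℝ] ℝ) (X s) := by
    convert! hF'.hasFDerivAt using 1
  have hs := hF.to_localInverse hfd hN
  rw [hFX.self_of_nhds] at hs
  refine hs.congr_of_eventuallyEq ?_
  have hsrc := hX.eventually ((hF.toOpenPartialHomeomorph F hfd hN).open_source.mem_nhds
    (hF.mem_toOpenPartialHomeomorph_source hfd hN))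
  filter_upwards [hsrc, hFX] with t ht hFt
  have := (hF.toOpenPartialHomeomorph F hfd hN).left_inv ht
  rw [hF.toOpenPartialHomeomorph_coe hfd hN, hFt] at this
  exact this.symm

end

/-! ### Distance from the pole -/

/-- The squared distance from the origin of the points with cosine `x` of the hypersurface with
profile `k`, translated along the axis so that it passes through the origin. -/
noncomputable def poleDistSq (k : ℝ → ℝ) (x : ℝ) : ℝ :=
  k x ^ 2 + 2 * k (-1) * (k x * x) + k (-1) ^ 2

/-- The derivative of `poleDistSq`. -/
noncomputable def poleDistSqDeriv (k : ℝ → ℝ) (x : ℝ) : ℝ :=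
  2 * k x * deriv k x + 2 * k (-1) * (k x + x * deriv k x)

/-- The properties of a profile that make the curvature a `C^1` function of the distance from
the pole of the hypersurface, which extends by a constant. -/
structure IsMonotoneProfile (k : ℝ → ℝ) : Prop where
  contDiff : ContDiff ℝ 3 k
  smooth : SmoothInCos k
  smooth_deriv : SmoothInCos (deriv k)
  pos : ∀ x ∈ Icc (-1 : ℝ) 1, 0 < k x
  poleDistSqDeriv_pos : ∀ x ∈ Icc (-1 : ℝ) 1, 0 < poleDistSqDeriv k x
  deriv_one : deriv k 1 = 0
  deriv_deriv_one : deriv (deriv k) 1 = 0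

theorem poleDistSq_neg_one (k : ℝ → ℝ) : poleDistSq k (-1) = 0 := by
  simp only [poleDistSq]
  ring

theorem poleDistSq_one (k : ℝ → ℝ) : poleDistSq k 1 = (k 1 + k (-1)) ^ 2 := by
  simp only [poleDistSq]
  ring

theorem one_mem_Icc_neg_one_one : (1 : ℝ) ∈ Icc (-1 : ℝ) 1 := by simp

theorem neg_one_mem_Icc_neg_one_one : (-1 : ℝ) ∈ Icc (-1 : ℝ) 1 := by simp

theorem hasDerivAt_poleDistSq {k : ℝ → ℝ} {x : ℝ} (hk : DifferentiableAt ℝ k x) :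
    HasDerivAt (poleDistSq k) (poleDistSqDeriv k x) x := by
  have h1 := ((hk.hasDerivAt.pow 2).add
    ((hk.hasDerivAt.mul (hasDerivAt_id' x)).const_mul (2 * k (-1)))).add_const (k (-1) ^ 2)
  convert! h1 using 1
  simp only [poleDistSqDeriv]
  push_cast
  ring

/-- On the translated graph the distance to the origin depends only on `⟨e, w⟩`, as does the mean
curvature; this lets the latter be prescribed by a radial function. -/
theorem norm_zonalGraph_pole {n : ℕ} {k : ℝ → ℝ} {c : ℝ} {e w : EuclideanSpace ℝ (Fin (n + 1))}
    (he : ‖e‖ = 1) (hw : ‖w‖ = 1) :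
    ‖zonalGraph k c e (c • k (-1) • e) w‖ ^ 2 = c ^ 2 * poleDistSq k (inner ℝ e w) := by
  rw [zonalGraph, norm_add_sq_real]
  simp only [norm_smul, he, hw, real_inner_smul_left, real_inner_smul_right, real_inner_comm e w,
    mul_pow, Real.norm_eq_abs, sq_abs, poleDistSq]
  ring

theorem SmoothInCos.contDiffAt {f : ℝ → ℝ} (hf : SmoothInCos f) {x : ℝ}
    (hx : x ∈ Ioo (-1 : ℝ) 1) : ContDiffAt ℝ ∞ f x := by
  have h1 : ContDiffAt ℝ ∞ (fun x => f (Real.cos (Real.arccos x))) x :=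
    (ContDiff.contDiffAt hf).comp x (Real.contDiffAt_arccos hx.1.ne' hx.2.ne)
  refine h1.congr_of_eventuallyEq ?_
  filter_upwards [Ioo_mem_nhds hx.1 hx.2] with y hy
  rw [Real.cos_arccos hy.1.le hy.2.le]

/-! ### The curvature function of a monotone profile -/

namespace IsMonotoneProfile

variable {n : ℕ} {k h : ℝ → ℝ} {ε : ℝ}

theorem contDiff_deriv (hk : IsMonotoneProfile k) : ContDiff ℝ 2 (deriv k) :=
  ContDiff.deriv_of_succ (by exact_mod_cast hk.contDiff)

theorem contDiff_deriv_deriv (hk : IsMonotoneProfile k) : ContDiff ℝ 1 (deriv (deriv k)) :=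
  ContDiff.deriv_of_succ (by exact_mod_cast hk.contDiff_deriv)

theorem contDiffAt_meanCurvature (hk : IsMonotoneProfile k) {x : ℝ} (hx : x ∈ Icc (-1 : ℝ) 1) :
    ContDiffAt ℝ 1 (zonalMeanCurvature n k) x :=
  contDiffAt_zonalMeanCurvature n (hk.contDiff.of_le (by norm_num)).contDiffAt
    (hk.contDiff_deriv.of_le (by norm_num)).contDiffAt hk.contDiff_deriv_deriv.contDiffAt hx
    (hk.pos x hx)

theorem hasDerivAt_poleDistSq (hk : IsMonotoneProfile k) (x : ℝ) :
    HasDerivAt (poleDistSq k) (poleDistSqDeriv k x) x :=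
  _root_.hasDerivAt_poleDistSq (hk.contDiff.differentiable (by simp) x)

theorem strictMonoOn_poleDistSq (hk : IsMonotoneProfile k) :
    StrictMonoOn (poleDistSq k) (Icc (-1) 1) := by
  refine strictMonoOn_of_deriv_pos (convex_Icc _ _)
    (fun x _ => (hk.hasDerivAt_poleDistSq x).continuousAt.continuousWithinAt) fun x hx => ?_
  rw [(hk.hasDerivAt_poleDistSq x).deriv]
  exact hk.poleDistSqDeriv_pos x (interior_subset hx)

theorem poleDistSq_mem (hk : IsMonotoneProfile k) {x : ℝ} (hx : x ∈ Icc (-1 : ℝ) 1) :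
    poleDistSq k x ∈ Icc 0 ((k 1 + k (-1)) ^ 2) := by
  rw [← poleDistSq_one, ← poleDistSq_neg_one k]
  exact ⟨hk.strictMonoOn_poleDistSq.monotoneOn neg_one_mem_Icc_neg_one_one hx hx.1,
    hk.strictMonoOn_poleDistSq.monotoneOn hx one_mem_Icc_neg_one_one hx.2⟩

theorem radius_pos (hk : IsMonotoneProfile k) : 0 < k 1 + k (-1) :=
  add_pos (hk.pos 1 one_mem_Icc_neg_one_one) (hk.pos (-1) neg_one_mem_Icc_neg_one_one)

/-- `exists_factorization` for `poleDistSq` and the mean curvature: `X` recovers the cosine from the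
squared distance, and `G` is the curvature as a function of it. -/
theorem exists_cosine (hk : IsMonotoneProfile k) (n : ℕ) :
    ∃ X G : ℝ → ℝ, Continuous X ∧ (∀ s, X s ∈ Icc (-1 : ℝ) 1) ∧
      (∀ x ∈ Icc (-1 : ℝ) 1, X (poleDistSq k x) = x) ∧
      (∀ s ∈ Icc 0 ((k 1 + k (-1)) ^ 2), poleDistSq k (X s) = s) ∧
      (∀ s, (k 1 + k (-1)) ^ 2 ≤ s → X s = 1) ∧
      (∀ s, 0 ≤ s → G s = zonalMeanCurvature n k (X s)) ∧
      Continuous (fun s => deriv (zonalMeanCurvature n k) (X s) / poleDistSqDeriv k (X s)) ∧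
      ∀ s, HasDerivAt G
        (deriv (zonalMeanCurvature n k) (X s) / poleDistSqDeriv k (X s)) s := by
  have hm : ∀ x ∈ Icc (-1 : ℝ) 1,
      HasDerivAt (zonalMeanCurvature n k) (deriv (zonalMeanCurvature n k) x) x :=
    fun x hx => ((hk.contDiffAt_meanCurvature hx).differentiableAt (by simp)).hasDerivAt
  have hm' : ContinuousOn (deriv (zonalMeanCurvature n k)) (Icc (-1) 1) := fun x hx => by
    have h1 : ContDiffAt ℝ 0 (fderiv ℝ (zonalMeanCurvature n k)) x :=
      (hk.contDiffAt_meanCurvature hx).fderiv_right (by simp)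
    exact (h1.continuousAt.clm_apply continuousAt_const).continuousWithinAt
  have hF' : ContinuousOn (poleDistSqDeriv k) (Icc (-1) 1) := by
    have h1 := hk.contDiff.continuous
    have h2 := hk.contDiff_deriv.continuous
    have : Continuous (poleDistSqDeriv k) := by
      unfold poleDistSqDeriv
      fun_prop
    exact this.continuousOn
  have := exists_factorization (by norm_num : (-1 : ℝ) < 1)
    (fun x _ => hk.hasDerivAt_poleDistSq x) hm hF' hm' hk.poleDistSqDeriv_pos
    (deriv_zonalMeanCurvature_one n hk.contDiff (hk.pos 1 one_mem_Icc_neg_one_one) hk.deriv_one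
      hk.deriv_deriv_one)
  rwa [poleDistSq_neg_one, poleDistSq_one] at this

theorem radiusEps_eq (hg : ∀ t, gEps h ε t = k (Real.cos t)) :
    radiusEps h ε = k 1 + k (-1) := by
  simp [radiusEps, hg]

theorem norm_sq_profileCurve (hg : ∀ t, gEps h ε t = k (Real.cos t)) (t : ℝ) :
    ‖profileCurve h ε t‖ ^ 2 = poleDistSq k (Real.cos t) := by
  rw [EuclideanSpace.real_norm_sq_eq, Fin.sum_univ_two]
  simp only [profileCurve, hg, Real.cos_pi, poleDistSq]
  simp only [Matrix.cons_val_zero, Matrix.cons_val_one]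
  linear_combination (k (Real.cos t)) ^ 2 * Real.sin_sq_add_cos_sq t

theorem norm_profileCurve_mem (hk : IsMonotoneProfile k)
    (hg : ∀ t, gEps h ε t = k (Real.cos t)) (t : ℝ) :
    ‖profileCurve h ε t‖ ∈ Icc 0 (radiusEps h ε) := by
  refine ⟨norm_nonneg _, ?_⟩
  rw [radiusEps_eq hg, ← pow_le_pow_iff_left₀ (norm_nonneg _) hk.radius_pos.le two_ne_zero,
    norm_sq_profileCurve hg]
  exact (hk.poleDistSq_mem (cos_mem_Icc_neg_one_one t)).2

theorem bijOn_norm_profileCurve (hk : IsMonotoneProfile k)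
    (hg : ∀ t, gEps h ε t = k (Real.cos t)) :
    BijOn (fun t => ‖profileCurve h ε t‖) (Icc 0 Real.pi) (Icc 0 (radiusEps h ε)) := by
  refine ⟨fun t _ => hk.norm_profileCurve_mem hg t, fun s hs t ht hst => ?_, fun r hr => ?_⟩
  · have h1 : ‖profileCurve h ε s‖ ^ 2 = ‖profileCurve h ε t‖ ^ 2 := congrArg (· ^ 2) hst
    rw [norm_sq_profileCurve hg, norm_sq_profileCurve hg] at h1
    exact Real.injOn_cos hs ht (hk.strictMonoOn_poleDistSq.injOn (cos_mem_Icc_neg_one_one s)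
      (cos_mem_Icc_neg_one_one t) h1)
  · obtain ⟨X, -, -, hX, -, hFX, -⟩ := hk.exists_cosine 0
    refine ⟨Real.arccos (X (r ^ 2)), ⟨Real.arccos_nonneg _, Real.arccos_le_pi _⟩, ?_⟩
    refine (pow_left_inj₀ (norm_nonneg _) hr.1 two_ne_zero).1 ?_
    rw [norm_sq_profileCurve hg, Real.cos_arccos (hX _).1 (hX _).2, hFX]
    rw [radiusEps_eq hg] at hr
    exact ⟨by positivity, pow_le_pow_left₀ hr.1 hr.2 2⟩

theorem isGreatest_norm_profileCurve (hk : IsMonotoneProfile k)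
    (hg : ∀ t, gEps h ε t = k (Real.cos t)) :
    IsGreatest ((fun t => ‖profileCurve h ε t‖) '' Icc (-Real.pi) Real.pi) (radiusEps h ε) := by
  refine ⟨⟨0, ⟨by linarith [Real.pi_pos], Real.pi_pos.le⟩, ?_⟩, ?_⟩
  · refine (pow_left_inj₀ (norm_nonneg _) ?_ two_ne_zero).1 ?_
    · rw [radiusEps_eq hg]
      exact hk.radius_pos.le
    · rw [norm_sq_profileCurve hg, Real.cos_zero, poleDistSq_one, radiusEps_eq hg]
  · rintro _ ⟨t, -, rfl⟩
    exact (hk.norm_profileCurve_mem hg t).2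

/-- The curvature function is given by one formula on the whole space. -/
theorem curvatureFun_eq (hn : 1 ≤ n) (hk : IsMonotoneProfile k)
    (hg : ∀ t, gEps h ε t = k (Real.cos t)) {X : ℝ → ℝ}
    (hXF : ∀ x ∈ Icc (-1 : ℝ) 1, X (poleDistSq k x) = x)
    (hX1 : ∀ s, (k 1 + k (-1)) ^ 2 ≤ s → X s = 1) (p : EuclideanSpace ℝ (Fin (n + 1))) :
    curvatureFun n h ε p = k 1 * zonalMeanCurvature n k (X (k 1 ^ 2 * ‖p‖ ^ 2)) := by
  have hk1 := hk.pos 1 one_mem_Icc_neg_one_one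
  have hg0 : gEps h ε 0 = k 1 := by simp [hg]
  rw [curvatureFun, hg0]
  split_ifs with hp
  · have hr : k 1 * ‖p‖ ∈ Icc 0 (radiusEps h ε) :=
      ⟨by positivity, by rwa [le_div_iff₀ hk1, mul_comm] at hp⟩
    have hs := (hk.bijOn_norm_profileCurve hg).surjOn hr
    have ht : ‖profileCurve h ε (angleOfDist h ε (k 1 * ‖p‖))‖ = k 1 * ‖p‖ := invFunOn_eq hs
    rw [← mul_pow, ← ht, norm_sq_profileCurve hg, hXF _ (cos_mem_Icc_neg_one_one _),
      ← revolutionMeanCurvature_comp_cos n (hk.contDiff.of_le (by norm_num))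
        (hk.pos _ (cos_mem_Icc_neg_one_one _)), ht, ← funext hg]
  · have hr : k 1 + k (-1) ≤ k 1 * ‖p‖ := by
      rw [not_le, radiusEps_eq hg, div_lt_iff₀ hk1, mul_comm] at hp
      exact hp.le
    rw [← mul_pow, hX1 _ (pow_le_pow_left₀ hk.radius_pos.le hr 2),
      zonalMeanCurvature_one hn hk1 hk.deriv_one]

/-- The function is `k(1) G(k(1)² |p|²)` with `G` of class `C^1`. Its gradient is zero where `k(1)
|p| ≥ k(1) + k(-1)`, and elsewhere this inequality, reversed, bounds the factor `|p|`. -/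
theorem exists_hasFDerivAt_curvatureFun (hn : 1 ≤ n) (hk : IsMonotoneProfile k)
    (hg : ∀ t, gEps h ε t = k (Real.cos t)) :
    ContDiff ℝ 1 (curvatureFun n h ε) ∧ ∀ p, ∃ x ∈ Icc (-1 : ℝ) 1,
      ‖fderiv ℝ (curvatureFun n h ε) p‖ ≤ 2 * k 1 ^ 2 * (k 1 + k (-1)) *
        (|deriv (zonalMeanCurvature n k) x| / poleDistSqDeriv k x) := by
  obtain ⟨X, G, hXc, hX, hXF, hFX, hX1, hGX, hc, hG⟩ := hk.exists_cosine n
  have hH : curvatureFun n h ε = fun p => k 1 * G (k 1 ^ 2 * ‖p‖ ^ 2) := funext fun p => by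
    rw [hk.curvatureFun_eq hn hg hXF hX1, hGX _ (by positivity)]
  have hGc : ContDiff ℝ 1 G := by
    refine contDiff_one_iff_deriv.2 ⟨fun s => (hG s).differentiableAt, ?_⟩
    rwa [funext fun s => (hG s).deriv]
  have hk1 := hk.pos 1 one_mem_Icc_neg_one_one
  refine ⟨?_, fun p => ⟨_, hX (k 1 ^ 2 * ‖p‖ ^ 2), ?_⟩⟩
  · rw [hH]
    exact contDiff_const.mul (hGc.comp (contDiff_const.mul (contDiff_id.norm_sq ℝ)))
  · have hd := ((hG (k 1 ^ 2 * ‖p‖ ^ 2)).comp_hasFDerivAt p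
      ((hasStrictFDerivAt_norm_sq p).hasFDerivAt.const_mul (k 1 ^ 2))).const_mul (k 1)
    have hfd : fderiv ℝ (curvatureFun n h ε) p = _ := hH ▸ hd.fderiv
    rw [hfd]
    rcases le_total ((k 1 + k (-1)) ^ 2) (k 1 ^ 2 * ‖p‖ ^ 2) with hs | hs
    · rw [hX1 _ hs, deriv_zonalMeanCurvature_one n hk.contDiff hk1 hk.deriv_one
        hk.deriv_deriv_one]
      simp
    · rw [← mul_pow, pow_le_pow_iff_left₀ (by positivity) hk.radius_pos.le two_ne_zero] at hs
      have hF := hk.poleDistSqDeriv_pos _ (hX (k 1 ^ 2 * ‖p‖ ^ 2))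
      have hnn : 0 ≤ |deriv (zonalMeanCurvature n k) (X (k 1 ^ 2 * ‖p‖ ^ 2))| /
        poleDistSqDeriv k (X (k 1 ^ 2 * ‖p‖ ^ 2)) := by positivity
      simp only [norm_smul, Real.norm_eq_abs, abs_div, abs_of_pos hF, abs_of_pos hk1, abs_pow]
      generalize |deriv (zonalMeanCurvature n k) (X (k 1 ^ 2 * ‖p‖ ^ 2))| /
        poleDistSqDeriv k (X (k 1 ^ 2 * ‖p‖ ^ 2)) = D at *
      have := mul_le_mul_of_nonneg_right hs (by positivity : 0 ≤ 2 * k 1 ^ 2 * D)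
      have h2 : ‖2 • innerSL ℝ p‖ = 2 * ‖p‖ := by
        rw [← Nat.cast_smul_eq_nsmul ℝ, norm_smul, innerSL_apply_norm]
        simp
      rw [h2]
      linarith

theorem exists_curvatureFun_eq (hn : 1 ≤ n) (hk : IsMonotoneProfile k)
    (hg : ∀ t, gEps h ε t = k (Real.cos t)) (p : EuclideanSpace ℝ (Fin (n + 1))) :
    ∃ x ∈ Icc (-1 : ℝ) 1, curvatureFun n h ε p = k 1 * zonalMeanCurvature n k x := by
  obtain ⟨X, G, -, hX, hXF, -, hX1, -⟩ := hk.exists_cosine n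
  exact ⟨_, hX _, hk.curvatureFun_eq hn hg hXF hX1 p⟩

/-- The axis is arbitrary because the curvature function is radial; the reference hypersurface is
the case of the last coordinate axis. -/
theorem isBubble_pole (hn : 1 ≤ n) (hk : IsMonotoneProfile k)
    (hg : ∀ t, gEps h ε t = k (Real.cos t)) {e : EuclideanSpace ℝ (Fin (n + 1))} (he : ‖e‖ = 1) :
    IsBubble (curvatureFun n h ε)
      (range fun w : UnitSphere n => zonalGraph k (k 1)⁻¹ e ((k 1)⁻¹ • k (-1) • e) w) := by
  have hk1 := hk.pos 1 one_mem_Icc_neg_one_one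
  obtain ⟨X, G, -, hX, hXF, -, hX1, -⟩ := hk.exists_cosine n
  refine isBubble_zonalGraph hn (hk.contDiff.of_le (by norm_num)) hk.smooth hk.smooth_deriv hk.pos
    (inv_pos.2 hk1) he fun q => ?_
  rw [hk.curvatureFun_eq hn hg hXF hX1, norm_zonalGraph_pole he (norm_eq_of_mem_sphere q),
    ← mul_assoc, ← mul_pow, mul_inv_cancel₀ hk1.ne', one_pow, one_mul,
    hXF _ (inner_mem_Icc he (norm_eq_of_mem_sphere q)), inv_inv]

theorem smul_refHypersurface_eq_range (hg : ∀ t, gEps h ε t = k (Real.cos t)) :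
    (gEps h ε 0)⁻¹ • refHypersurface n h ε = range fun w : UnitSphere n =>
      zonalGraph k (k 1)⁻¹ (EuclideanSpace.single (Fin.last n) 1)
        ((k 1)⁻¹ • k (-1) • EuclideanSpace.single (Fin.last n) 1) w := by
  have key : ∀ w ∈ Metric.sphere (0 : EuclideanSpace ℝ (Fin (n + 1))) 1,
      (gEps h ε 0)⁻¹ • (gEps h ε (Real.arccos (w (Fin.last n))) • w
        + gEps h ε Real.pi • EuclideanSpace.single (Fin.last n) (1 : ℝ)) =
      zonalGraph k (k 1)⁻¹ (EuclideanSpace.single (Fin.last n) 1)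
        ((k 1)⁻¹ • k (-1) • EuclideanSpace.single (Fin.last n) 1) w := fun w hw => by
    have hi : inner ℝ (EuclideanSpace.single (Fin.last n) (1 : ℝ)) w = w (Fin.last n) := by
      rw [EuclideanSpace.inner_single_left]
      simp
    have hx := inner_mem_Icc (e := EuclideanSpace.single (Fin.last n) (1 : ℝ)) (w := w) (by simp)
      (by simpa using hw)
    rw [hi] at hx
    rw [zonalGraph, hi, hg, hg, hg, Real.cos_zero, Real.cos_pi, Real.cos_arccos hx.1 hx.2,
      smul_add]
  ext p
  constructor
  · rintro ⟨_, ⟨w, hw, rfl⟩, rfl⟩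
    exact ⟨⟨w, hw⟩, (key w hw).symm⟩
  · rintro ⟨w, rfl⟩
    exact ⟨_, ⟨w.1, w.2, rfl⟩, key w.1 w.2⟩

end IsMonotoneProfile

/-! ### Bubbles through every point, and smoothness -/

theorem LinearIsometryEquiv.map_zonalGraph {n : ℕ} {k : ℝ → ℝ} {c : ℝ}
    (A : EuclideanSpace ℝ (Fin (n + 1)) ≃ₗᵢ[ℝ] EuclideanSpace ℝ (Fin (n + 1)))
    (e v w : EuclideanSpace ℝ (Fin (n + 1))) :
    A (zonalGraph k c e v w) = zonalGraph k c (A e) (A v) (A w) := by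
  simp [zonalGraph, A.inner_map_map]

theorem exists_unit_vectors_inner_eq {n : ℕ} (hn : 1 ≤ n) {x : ℝ} (hx : x ∈ Icc (-1 : ℝ) 1) :
    ∃ e w : EuclideanSpace ℝ (Fin (n + 1)), ‖e‖ = 1 ∧ ‖w‖ = 1 ∧ inner ℝ e w = x := by
  have h0 : (0 : Fin (n + 1)) ≠ Fin.last n := by
    rw [Ne, Fin.ext_iff, Fin.val_last, Fin.val_zero]
    omega
  have hr : 0 ≤ 1 - x ^ 2 := by nlinarith [hx.1, hx.2]
  have hor : inner ℝ (EuclideanSpace.single (Fin.last n) (1 : ℝ))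
      (EuclideanSpace.single (0 : Fin (n + 1)) (1 : ℝ)) = 0 := by
    rw [EuclideanSpace.inner_single_left]
    simp [h0]
  refine ⟨EuclideanSpace.single (Fin.last n) 1, x • EuclideanSpace.single (Fin.last n) 1 +
    √(1 - x ^ 2) • EuclideanSpace.single 0 1, by simp, ?_, ?_⟩
  · rw [← pow_eq_one_iff_of_nonneg (norm_nonneg _) two_ne_zero, norm_add_sq_real,
      real_inner_smul_left, real_inner_smul_right, hor, norm_smul, norm_smul]
    simp [Real.sq_sqrt hr]
  · rw [inner_add_right, real_inner_smul_right, real_inner_smul_right, hor,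
      real_inner_self_eq_norm_sq]
    simp

theorem isBubble_unitSphere {n : ℕ} (hn : 1 ≤ n) (v : EuclideanSpace ℝ (Fin (n + 1)))
    {H : EuclideanSpace ℝ (Fin (n + 1)) → ℝ} (hH : ∀ w, ‖w‖ = 1 → H (w + v) = 1) :
    IsBubble H (range fun w : UnitSphere n => w.1 + v) := by
  have h1 : SmoothInCos fun _ => 1 := contDiff_const
  have h2 : SmoothInCos (deriv fun _ => (1 : ℝ)) := by
    simp only [deriv_const']
    exact contDiff_const
  have := isBubble_zonalGraph (v := v) (H := H) hn (contDiff_const (c := (1 : ℝ))) h1 h2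
    (fun _ _ => one_pos) one_pos (e := EuclideanSpace.single (Fin.last n) 1) (by simp)
    (fun q => by
      rw [zonalMeanCurvature_const_one hn]
      simpa [zonalGraph] using hH q.1 (norm_eq_of_mem_sphere q))
  simpa [zonalGraph] using this

namespace IsMonotoneProfile

variable {n : ℕ} {k h : ℝ → ℝ} {ε : ℝ}

theorem exists_isBubble_mem (hn : 1 ≤ n) (hk : IsMonotoneProfile k)
    (hg : ∀ t, gEps h ε t = k (Real.cos t)) (p : EuclideanSpace ℝ (Fin (n + 1))) :
    ∃ S, IsBubble (curvatureFun n h ε) S ∧ p ∈ S := by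
  have hk1 := hk.pos 1 one_mem_Icc_neg_one_one
  rcases le_or_gt ‖p‖ (radiusEps h ε / gEps h ε 0) with hp | hp
  · obtain ⟨X, -, -, hX, -, hFX, -⟩ := hk.exists_cosine 0
    obtain ⟨e, w, he, hw, hew⟩ := exists_unit_vectors_inner_eq hn (hX (k 1 ^ 2 * ‖p‖ ^ 2))
    have hq : ‖zonalGraph k (k 1)⁻¹ e ((k 1)⁻¹ • k (-1) • e) w‖ = ‖p‖ := by
      refine (pow_left_inj₀ (norm_nonneg _) (norm_nonneg _) two_ne_zero).1 ?_
      rw [norm_zonalGraph_pole he hw, hew, hFX]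
      · field_simp
      · rw [radiusEps_eq hg, le_div_iff₀ (by rwa [hg, Real.cos_zero]), hg, Real.cos_zero,
          mul_comm] at hp
        rw [← mul_pow]
        exact ⟨by positivity, pow_le_pow_left₀ (by positivity) hp 2⟩
    -- The reflection exchanging two vectors of equal norm carries a point of the graph at distance
    -- `‖p‖` to `p`, and the graph to the one with axis `A e`.
    have hA := Submodule.reflection_sub hq
    set A := (ℝ ∙ (zonalGraph k (k 1)⁻¹ e ((k 1)⁻¹ • k (-1) • e) w - p))ᗮ.reflection
    refine ⟨_, hk.isBubble_pole hn hg (e := A e) (by simp [he]), ⟨A w, by simp [hw]⟩, ?_⟩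
    rw [A.map_zonalGraph, map_smul, map_smul] at hA
    exact hA
  · have hR : 0 < radiusEps h ε / gEps h ε 0 := by
      rw [radiusEps_eq hg, hg, Real.cos_zero]
      exact div_pos hk.radius_pos hk1
    have hp0 : 0 < ‖p‖ := hR.trans hp
    have hu : ‖‖p‖⁻¹ • p‖ = 1 := by
      rw [norm_smul, norm_inv, norm_norm, inv_mul_cancel₀ hp0.ne']
    -- The unit sphere centred at `p + p/‖p‖` touches the ball of radius `‖p‖` from outside at `p`,
    -- so all its points have norm at least `‖p‖`.
    refine ⟨_, isBubble_unitSphere hn (p + ‖p‖⁻¹ • p) fun w hw => ?_,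
      ⟨-(‖p‖⁻¹ • p), by simp [hu]⟩, by simp⟩
    rw [curvatureFun, if_neg]
    rw [not_le]
    refine hp.trans_le ?_
    have h1 : ‖p + ‖p‖⁻¹ • p‖ = ‖p‖ + 1 := by
      rw [show p + ‖p‖⁻¹ • p = (1 + ‖p‖⁻¹) • p by module, norm_smul,
        Real.norm_of_nonneg (by positivity)]
      field_simp
    have h2 := norm_sub_le (w + (p + ‖p‖⁻¹ • p)) w
    rw [add_sub_cancel_left, h1, hw] at h2
    linarith

/-- Where the angle is near `0` or `π` the profile is locally constant and the curvature is `1`.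
Elsewhere the cosine lies in `(-1, 1)`, where `k` is smooth, and `X` is smooth by the inverse
function theorem. -/
theorem contDiff_curvatureFun (hn : 1 ≤ n) (hk : IsMonotoneProfile k)
    (hg : ∀ t, gEps h ε t = k (Real.cos t)) (h0 : h =ᶠ[𝓝 0] 0) (hpi : h =ᶠ[𝓝 Real.pi] 0) :
    ContDiff ℝ ∞ (curvatureFun n h ε) := by
  obtain ⟨X, G, hXc, hX, hXF, hFX, hX1, hGX, hc, hG⟩ := hk.exists_cosine n
  rw [funext fun p => hk.curvatureFun_eq hn hg hXF hX1 p, contDiff_iff_contDiffAt]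
  intro p
  have hk1 := hk.pos 1 one_mem_Icc_neg_one_one
  have hk1' : k 1 = 1 := by
    rw [← Real.cos_zero, ← hg, gEps, h0.self_of_nhds]
    simp
  have hσ : ContDiff ℝ ∞ fun p : EuclideanSpace ℝ (Fin (n + 1)) => k 1 ^ 2 * ‖p‖ ^ 2 :=
    contDiff_const.mul (contDiff_id.norm_sq ℝ)
  have hXσ : Continuous fun p : EuclideanSpace ℝ (Fin (n + 1)) => X (k 1 ^ 2 * ‖p‖ ^ 2) :=
    hXc.comp hσ.continuous
  have hconst : h =ᶠ[𝓝 (Real.arccos (X (k 1 ^ 2 * ‖p‖ ^ 2)))] 0 → ContDiffAt ℝ ∞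
      (fun p : EuclideanSpace ℝ (Fin (n + 1)) =>
        k 1 * zonalMeanCurvature n k (X (k 1 ^ 2 * ‖p‖ ^ 2))) p := fun hp => by
    refine (contDiffAt_const (c := (1 : ℝ))).congr_of_eventuallyEq ?_
    -- The vanishing of `h` is needed on a whole neighbourhood of each nearby angle, so that the
    -- derivatives of the profile there also agree with those of the constant `1`.
    filter_upwards [(Real.continuous_arccos.comp hXσ).continuousAt.eventually
      hp.eventually_nhds] with q hq
    have hq' : (fun t => k (Real.cos t)) =ᶠ[𝓝 (Real.arccos (X (k 1 ^ 2 * ‖q‖ ^ 2)))]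
        fun _ => (1 : ℝ) := by
      filter_upwards [hq] with t ht
      rw [← hg, gEps, ht]
      simp
    have hx := hX (k 1 ^ 2 * ‖q‖ ^ 2)
    have hcos := Real.cos_arccos hx.1 hx.2
    have h1 := revolutionMeanCurvature_comp_cos n (hk.contDiff.of_le (by norm_num))
      (t := Real.arccos (X (k 1 ^ 2 * ‖q‖ ^ 2))) (hk.pos _ (cos_mem_Icc_neg_one_one _))
    have h2 := revolutionMeanCurvature_comp_cos n (k := fun _ => 1) contDiff_const
      (t := Real.arccos (X (k 1 ^ 2 * ‖q‖ ^ 2))) one_pos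
    have h3 : revolutionMeanCurvature n (fun t => k (Real.cos t))
        (Real.arccos (X (k 1 ^ 2 * ‖q‖ ^ 2))) = revolutionMeanCurvature n (fun _ => 1)
        (Real.arccos (X (k 1 ^ 2 * ‖q‖ ^ 2))) := by
      simp only [revolutionMeanCurvature, parallelCurvature, meridianCurvature,
        hq'.deriv.deriv_eq, hq'.deriv_eq, hq'.self_of_nhds]
    rw [h1, h2, zonalMeanCurvature_const_one hn, hcos] at h3
    rw [h3, hk1', one_mul]
  rcases eq_or_ne (X (k 1 ^ 2 * ‖p‖ ^ 2)) 1 with hx1 | hx1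
  · exact hconst (by rwa [hx1, Real.arccos_one])
  rcases eq_or_ne (X (k 1 ^ 2 * ‖p‖ ^ 2)) (-1) with hx2 | hx2
  · exact hconst (by rwa [hx2, Real.arccos_neg_one])
  have hx : X (k 1 ^ 2 * ‖p‖ ^ 2) ∈ Ioo (-1 : ℝ) 1 :=
    ⟨(hX _).1.lt_of_ne' hx2, (hX _).2.lt_of_ne hx1⟩
  have hs : k 1 ^ 2 * ‖p‖ ^ 2 ∈ Ioo 0 ((k 1 + k (-1)) ^ 2) := by
    refine ⟨(by positivity : 0 ≤ k 1 ^ 2 * ‖p‖ ^ 2).lt_of_ne fun h => hx2 ?_,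
      not_le.1 fun h => hx1 (hX1 _ h)⟩
    rw [← h, ← poleDistSq_neg_one k, hXF _ neg_one_mem_Icc_neg_one_one]
  have ck : ContDiffAt ℝ ∞ k (X (k 1 ^ 2 * ‖p‖ ^ 2)) := hk.smooth.contDiffAt hx
  have ck1 : ContDiffAt ℝ ∞ (deriv k) (X (k 1 ^ 2 * ‖p‖ ^ 2)) := hk.smooth_deriv.contDiffAt hx
  have ck2 : ContDiffAt ℝ ∞ (deriv (deriv k)) (X (k 1 ^ 2 * ‖p‖ ^ 2)) := by
    have h1 : ContDiffAt ℝ ∞ (fderiv ℝ (deriv k)) (X (k 1 ^ 2 * ‖p‖ ^ 2)) :=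
      ck1.fderiv_right (by simp)
    exact h1.clm_apply contDiffAt_const
  have cF : ContDiffAt ℝ ∞ (poleDistSq k) (X (k 1 ^ 2 * ‖p‖ ^ 2)) :=
    ((ck.pow 2).add (contDiffAt_const.mul (ck.mul contDiffAt_id))).add contDiffAt_const
  have cX : ContDiffAt ℝ ∞ X (k 1 ^ 2 * ‖p‖ ^ 2) :=
    contDiffAt_of_rightInverse (by simp) hXc.continuousAt cF (hk.hasDerivAt_poleDistSq _)
      (hk.poleDistSqDeriv_pos _ (hX _)).ne' (by
        filter_upwards [Ioo_mem_nhds hs.1 hs.2] with s hs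
        exact hFX s ⟨hs.1.le, hs.2.le⟩)
  have cm := contDiffAt_zonalMeanCurvature n ck ck1 ck2 (hX _) (hk.pos _ (hX _))
  have cXσ : ContDiffAt ℝ ∞ (fun p : EuclideanSpace ℝ (Fin (n + 1)) =>
    X (k 1 ^ 2 * ‖p‖ ^ 2)) p := cX.comp p hσ.contDiffAt
  have cmX : ContDiffAt ℝ ∞ (fun p : EuclideanSpace ℝ (Fin (n + 1)) =>
    zonalMeanCurvature n k (X (k 1 ^ 2 * ‖p‖ ^ 2))) p :=
    ContDiffAt.comp (g := zonalMeanCurvature n k) p cm cXσ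
  exact contDiffAt_const.mul cmX

end IsMonotoneProfile

/-! ### Perturbations of the constant profile -/

section

variable {n : ℕ} {k : ℝ → ℝ}

theorem deriv_one_add_mul (k : ℝ → ℝ) (ε : ℝ) :
    deriv (fun x => 1 + ε * k x) = fun x => ε * deriv k x := by
  funext x
  simp

theorem eventually_forall_mem_Icc {P : ℝ → ℝ → Prop}
    (hP : ∀ x ∈ Icc (-1 : ℝ) 1, ∀ᶠ z : ℝ × ℝ in 𝓝 (0, x), P z.1 z.2) :
    ∀ᶠ ε in 𝓝 (0 : ℝ), ∀ x ∈ Icc (-1 : ℝ) 1, P ε x :=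
  isCompact_Icc.eventually_forall_of_forall_eventually hP

theorem contDiffAt_zonalMeanCurvature_one_add_mul (n : ℕ) (hk : ContDiff ℝ 3 k) {ε x : ℝ}
    (hx : x ∈ Icc (-1 : ℝ) 1) (hpos : 0 < 1 + ε * k x) :
    ContDiffAt ℝ 1 (fun z : ℝ × ℝ => zonalMeanCurvature n (fun x => 1 + z.1 * k x) z.2)
      (ε, x) := by
  have hk1 : ContDiff ℝ 2 (deriv k) := ContDiff.deriv_of_succ (by exact_mod_cast hk)
  have hk2 : ContDiff ℝ 1 (deriv (deriv k)) := ContDiff.deriv_of_succ (by exact_mod_cast hk1)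
  simp only [zonalMeanCurvature, zonalSpeed, deriv_one_add_mul]
  have c0 : ContDiff ℝ 1 fun z : ℝ × ℝ => k z.2 := (hk.of_le (by norm_num)).comp contDiff_snd
  have c1 : ContDiff ℝ 1 fun z : ℝ × ℝ => deriv k z.2 :=
    (hk1.of_le (by norm_num)).comp contDiff_snd
  have c2 : ContDiff ℝ 1 fun z : ℝ × ℝ => deriv (deriv k) z.2 := hk2.comp contDiff_snd
  simpa only [deriv_const_mul_field] using contDiffAt_zonalMeanCurvature_expr n
    (p := fun z : ℝ × ℝ => 1 + z.1 * k z.2) (q := fun z => z.1 * deriv k z.2)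
    (r := fun z => z.1 * deriv (deriv k) z.2) (y := fun z => z.2) (z := (ε, x))
    (contDiff_const.add (contDiff_fst.mul c0)).contDiffAt (contDiff_fst.mul c1).contDiffAt
    (contDiff_fst.mul c2).contDiffAt contDiffAt_snd hx hpos

theorem eventually_one_add_mul_mem (hk : Continuous k) (x : ℝ) {u v : ℝ} (hu : u < 1)
    (hv : 1 < v) : ∀ᶠ z : ℝ × ℝ in 𝓝 (0, x), 1 + z.1 * k z.2 ∈ Ioo u v := by
  have hc : Continuous fun z : ℝ × ℝ => 1 + z.1 * k z.2 := by fun_prop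
  exact hc.continuousAt.eventually (Ioo_mem_nhds (by simpa using hu) (by simpa using hv))

theorem eventually_poleDistSqDeriv_gt_one (hk : ContDiff ℝ 3 k) (x : ℝ) :
    ∀ᶠ z : ℝ × ℝ in 𝓝 (0, x), 1 < poleDistSqDeriv (fun x => 1 + z.1 * k x) z.2 := by
  have h0 := hk.continuous
  have h1 : Continuous (deriv k) := hk.continuous_deriv (by norm_num)
  simp only [poleDistSqDeriv, deriv_one_add_mul]
  have hc : Continuous fun z : ℝ × ℝ => 2 * (1 + z.1 * k z.2) * (z.1 * deriv k z.2) +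
      2 * (1 + z.1 * k (-1)) * (1 + z.1 * k z.2 + z.2 * (z.1 * deriv k z.2)) := by fun_prop
  exact hc.continuousAt.eventually_const_lt (by simp)

theorem eventually_zonalMeanCurvature_mem (hn : 1 ≤ n) (hk : ContDiff ℝ 3 k) {u v : ℝ}
    (hu : u < 1) (hv : 1 < v) : ∀ᶠ ε in 𝓝 (0 : ℝ), ∀ x ∈ Icc (-1 : ℝ) 1,
      (1 + ε * k 1) * zonalMeanCurvature n (fun x => 1 + ε * k x) x ∈ Ioo u v := by
  refine eventually_forall_mem_Icc fun x hx => ?_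
  have hc := (contDiffAt_zonalMeanCurvature_one_add_mul n hk (ε := 0) hx (by simp)).continuousAt
  have hc1 : Continuous fun z : ℝ × ℝ => 1 + z.1 * k 1 := by fun_prop
  refine (hc1.continuousAt.mul hc).eventually (Ioo_mem_nhds ?_ ?_) <;>
  simpa [zonalMeanCurvature_const_one hn]

theorem eventually_abs_deriv_zonalMeanCurvature_lt (hn : 1 ≤ n) (hk : ContDiff ℝ 3 k) {η : ℝ}
    (hη : 0 < η) : ∀ᶠ ε in 𝓝 (0 : ℝ), ∀ x ∈ Icc (-1 : ℝ) 1,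
      |deriv (zonalMeanCurvature n fun x => 1 + ε * k x) x| < η := by
  have hderiv : ∀ {ε x : ℝ}, x ∈ Icc (-1 : ℝ) 1 → 0 < 1 + ε * k x →
      deriv (zonalMeanCurvature n fun x => 1 + ε * k x) x =
        fderiv ℝ (fun z : ℝ × ℝ => zonalMeanCurvature n (fun x => 1 + z.1 * k x) z.2) (ε, x)
          (0, 1) := fun {ε x} hx hpos => by
    have h1 := ((contDiffAt_zonalMeanCurvature_one_add_mul n hk hx hpos).differentiableAt
      (by simp)).hasFDerivAt
    exact (h1.comp_hasDerivAt x ((hasDerivAt_const x ε).prodMk (hasDerivAt_id x))).deriv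
  -- The repeated membership is deliberate: a neighbourhood of `(0, x)` contains points whose second
  -- coordinate leaves `[-1, 1]`, where `hderiv` does not apply.
  have key : ∀ᶠ ε in 𝓝 (0 : ℝ), ∀ x ∈ Icc (-1 : ℝ) 1, x ∈ Icc (-1 : ℝ) 1 →
      |deriv (zonalMeanCurvature n fun x => 1 + ε * k x) x| < η := by
    refine eventually_forall_mem_Icc fun x hx => ?_
    have h1 : ContDiffAt ℝ 0 (fderiv ℝ fun z : ℝ × ℝ =>
        zonalMeanCurvature n (fun x => 1 + z.1 * k x) z.2) (0, x) :=
      (contDiffAt_zonalMeanCurvature_one_add_mul n hk hx (by simp)).fderiv_right (by simp)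
    have h2 := (h1.continuousAt.clm_apply
      (continuousAt_const (y := ((0 : ℝ), (1 : ℝ))))).abs.eventually_lt_const (u := η) (by
        beta_reduce
        rw [← hderiv hx (by simp)]
        have : zonalMeanCurvature n (fun _ => (1 : ℝ)) = fun _ => 1 :=
          funext (zonalMeanCurvature_const_one hn)
        simpa [this] using hη)
    filter_upwards [h2, eventually_one_add_mul_mem hk.continuous x zero_lt_one one_lt_two] with
      z hz hz' hzx
    rwa [hderiv hzx hz'.1]
  filter_upwards [key] with ε hε x hx using hε x hx hx

theorem eventually_isMonotoneProfile (hk : ContDiff ℝ 3 k) (hs : SmoothInCos k)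
    (hs' : SmoothInCos (deriv k)) (h1 : deriv k 1 = 0) (h2 : deriv (deriv k) 1 = 0) :
    ∀ᶠ ε in 𝓝 (0 : ℝ), IsMonotoneProfile (fun x => 1 + ε * k x) ∧
      (∀ x ∈ Icc (-1 : ℝ) 1, 1 + ε * k x < 2) ∧
      ∀ x ∈ Icc (-1 : ℝ) 1, 1 < poleDistSqDeriv (fun x => 1 + ε * k x) x := by
  filter_upwards [eventually_forall_mem_Icc (P := fun ε x => 1 + ε * k x ∈ Ioo (0 : ℝ) 2)
    fun x _ => eventually_one_add_mul_mem hk.continuous x zero_lt_one one_lt_two,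
    eventually_forall_mem_Icc
      (P := fun ε x => 1 < poleDistSqDeriv (fun x => 1 + ε * k x) x)
      fun x _ => eventually_poleDistSqDeriv_gt_one hk x] with ε hε hε'
  refine ⟨⟨contDiff_const.add (contDiff_const.mul hk), contDiff_const.add (contDiff_const.mul hs),
    ?_, fun x hx => (hε x hx).1, fun x hx => one_pos.trans (hε' x hx), ?_, ?_⟩,
    fun x hx => (hε x hx).2, hε'⟩
  · rw [deriv_one_add_mul]
    exact contDiff_const.mul hs'
  · simp [h1]
  · simp [h2]

theorem tendstoUniformly_curvatureFun {h : ℝ → ℝ} (hn : 1 ≤ n) (hk : ContDiff ℝ 3 k)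
    (hkh : ∀ t, k (Real.cos t) = h t)
    (hev : ∀ᶠ ε in 𝓝 (0 : ℝ), IsMonotoneProfile (fun x => 1 + ε * k x)) :
    TendstoUniformly (fun ε p => curvatureFun n h ε p) (fun _ => 1) (𝓝 0) := by
  refine Metric.tendstoUniformly_iff.2 fun η hη => ?_
  filter_upwards [hev, eventually_zonalMeanCurvature_mem hn hk (sub_lt_self 1 hη)
    (lt_add_of_pos_right 1 hη)] with ε hε hm p
  obtain ⟨x, hx, hpx⟩ := hε.exists_curvatureFun_eq hn (h := h) (ε := ε)
    (fun t => by rw [gEps, hkh]) p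
  have := hm x hx
  rw [hpx, Real.dist_eq, abs_sub_lt_iff]
  exact ⟨by linarith [this.1], by linarith [this.2]⟩

theorem tendstoUniformly_fderiv_curvatureFun {h : ℝ → ℝ} (hn : 1 ≤ n) (hk : ContDiff ℝ 3 k)
    (hkh : ∀ t, k (Real.cos t) = h t)
    (hev : ∀ᶠ ε in 𝓝 (0 : ℝ), IsMonotoneProfile (fun x => 1 + ε * k x) ∧
      (∀ x ∈ Icc (-1 : ℝ) 1, 1 + ε * k x < 2) ∧
      ∀ x ∈ Icc (-1 : ℝ) 1, 1 < poleDistSqDeriv (fun x => 1 + ε * k x) x) :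
    TendstoUniformly (fun ε p => fderiv ℝ (curvatureFun n h ε) p) (fun _ => 0) (𝓝 0) := by
  refine Metric.tendstoUniformly_iff.2 fun η hη => ?_
  -- The constant 32 is `2 · 2² · (2 + 2)`, the bound on the prefactor of the gradient estimate when
  -- the profile is below 2.
  filter_upwards [hev, eventually_abs_deriv_zonalMeanCurvature_lt hn hk
    (div_pos hη (by norm_num : (0 : ℝ) < 32))] with ε ⟨hε, hlt, hgt⟩ hm p
  obtain ⟨x, hx, hpx⟩ := (hε.exists_hasFDerivAt_curvatureFun hn (h := h) (ε := ε)
    (fun t => by rw [gEps, hkh])).2 p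
  rw [dist_zero_left]
  refine hpx.trans_lt ?_
  have h1 := hlt 1 one_mem_Icc_neg_one_one
  have h2 := hlt (-1) neg_one_mem_Icc_neg_one_one
  have h1' := hε.pos 1 one_mem_Icc_neg_one_one
  have h2' := hε.pos (-1) neg_one_mem_Icc_neg_one_one
  have h3 : |deriv (zonalMeanCurvature n fun x => 1 + ε * k x) x| /
      poleDistSqDeriv (fun x => 1 + ε * k x) x < η / 32 :=
    (div_le_self (abs_nonneg _) (hgt x hx).le).trans_lt (hm x hx)
  have h4 : 2 * (1 + ε * k 1) ^ 2 * (1 + ε * k 1 + (1 + ε * k (-1))) < 2 * 2 ^ 2 * (2 + 2) := by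
    gcongr
  calc _ ≤ 2 * 2 ^ 2 * (2 + 2) * (|deriv (zonalMeanCurvature n fun x => 1 + ε * k x) x| /
        poleDistSqDeriv (fun x => 1 + ε * k x) x) := by
        refine mul_le_mul_of_nonneg_right h4.le (div_nonneg (abs_nonneg _) ?_)
        exact (one_pos.trans (hgt x hx)).le
    _ < 2 * 2 ^ 2 * (2 + 2) * (η / 32) := by gcongr
    _ = η := by ring

end

/-! ### The main theorem -/

theorem theorem1 (n : ℕ) (hn : 1 ≤ n) (h : ℝ → ℝ) (hsmooth : ContDiff ℝ ∞ h)
    (heven : Function.Even h) (hper : Function.Periodic h (2 * Real.pi))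
    (h0 : iteratedDeriv 2 h 0 = 0) (h0' : iteratedDeriv 4 h 0 = 0)
    (hpi : iteratedDeriv 2 h Real.pi = 0) :
    ∃ ε₀ : ℝ, 0 < ε₀ ∧
      (∀ ε : ℝ, |ε| < ε₀ →
        -- the objects in the definition of `H_ε` are well defined
        (∀ t, 0 < gEps h ε t) ∧
        BijOn (fun t => ‖profileCurve h ε t‖) (Icc 0 Real.pi) (Icc 0 (radiusEps h ε)) ∧
        IsGreatest ((fun t => ‖profileCurve h ε t‖) '' Icc (-Real.pi) Real.pi)
          (radiusEps h ε) ∧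
        -- regularity, positivity and boundedness, filling property
        ContDiff ℝ 1 (curvatureFun n h ε) ∧
        (∃ C₁ C₂ : ℝ, 0 < C₁ ∧ 0 < C₂ ∧
          ∀ p, C₁ ≤ curvatureFun n h ε p ∧ curvatureFun n h ε p ≤ C₂) ∧
        (∀ p, ∃ S, IsBubble (curvatureFun n h ε) S ∧ p ∈ S) ∧
        -- radial symmetry, and the value outside the ball
        (∀ p q, ‖p‖ = ‖q‖ → curvatureFun n h ε p = curvatureFun n h ε q) ∧
        (∀ p, radiusEps h ε / gEps h ε 0 < ‖p‖ → curvatureFun n h ε p = 1) ∧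
        -- `H_ε` is the mean curvature of the rescaled reference hypersurface
        IsBubble (curvatureFun n h ε) ((gEps h ε 0)⁻¹ • refHypersurface n h ε)) ∧
      -- limits as `ε → 0`
      Tendsto (fun ε => radiusEps h ε) (𝓝 0) (𝓝 2) ∧
      Tendsto (fun ε => radiusEps h ε / gEps h ε 0) (𝓝 0) (𝓝 2) ∧
      TendstoUniformly (fun ε p => curvatureFun n h ε p) (fun _ => 1) (𝓝 0) ∧
      TendstoUniformly (fun ε p => fderiv ℝ (curvatureFun n h ε) p) (fun _ => 0) (𝓝 0) ∧
      -- smoothness when `h` vanishes near `0` and `π`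
      (h =ᶠ[𝓝 0] 0 → h =ᶠ[𝓝 Real.pi] 0 →
        ∀ ε : ℝ, |ε| < ε₀ → ContDiff ℝ ∞ (curvatureFun n h ε)) := by
  -- Order `3 + 1 = 4` is what the fourth derivative at `0` requires; afterwards three derivatives
  -- suffice.
  obtain ⟨k, hk4, hkh, hs'⟩ := SmoothEvenPeriodic.exists_contDiff_smoothInCos
    (g := h) ⟨hsmooth, heven, hper⟩ 3
  have hk4 : ContDiff ℝ 4 k := by exact_mod_cast hk4
  have hk : ContDiff ℝ 3 k := hk4.of_le (by norm_num)
  have hs : SmoothInCos k := by rwa [SmoothInCos, funext hkh]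
  have hd1 : deriv k 1 = 0 := by
    rw [← funext hkh, iteratedDeriv_two_comp_cos_zero (hk.of_le (by norm_num))] at h0
    linarith
  have hd2 : deriv (deriv k) 1 = 0 := by
    rw [← funext hkh, iteratedDeriv_four_comp_cos_zero hk4] at h0'
    linarith
  have hg : ∀ ε t, gEps h ε t = 1 + ε * k (Real.cos t) := fun ε t => by rw [gEps, hkh]
  have hev := eventually_isMonotoneProfile hk hs hs' hd1 hd2
  have hev1 := hev.mono fun ε hε => hε.1
  -- A single `ε₀` gives both a monotone profile and the bounds `1/2` and `2` for the curvature.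
  obtain ⟨ε₀, hε₀, hball⟩ := Metric.eventually_nhds_iff.1
    (hev1.and (eventually_zonalMeanCurvature_mem hn hk (u := 1 / 2) (v := 2)
      (by norm_num) (by norm_num)))
  have hgood : ∀ ε : ℝ, |ε| < ε₀ → _ := fun ε hε => hball (y := ε) (by simpa using hε)
  have hR : Tendsto (fun ε => radiusEps h ε) (𝓝 0) (𝓝 2) := by
    have : Continuous fun ε => radiusEps h ε := by
      unfold radiusEps gEps
      fun_prop
    exact this.tendsto' 0 2 (by norm_num [radiusEps, gEps])
  refine ⟨ε₀, hε₀, fun ε hε => ?_, hR, ?_, tendstoUniformly_curvatureFun hn hk hkh hev1,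
    tendstoUniformly_fderiv_curvatureFun hn hk hkh hev, fun hz hzpi ε hε =>
      (hgood ε hε).1.contDiff_curvatureFun hn (hg ε) hz hzpi⟩
  · obtain ⟨hm, hmem⟩ := hgood ε hε
    refine ⟨fun t => ?_, hm.bijOn_norm_profileCurve (hg ε), hm.isGreatest_norm_profileCurve (hg ε),
      (hm.exists_hasFDerivAt_curvatureFun hn (hg ε)).1,
      ⟨1 / 2, 2, by norm_num, by norm_num, fun p => ?_⟩, hm.exists_isBubble_mem hn (hg ε),
      fun p q hpq => by simp only [curvatureFun, hpq], fun p hp => by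
        rw [curvatureFun, if_neg (not_le.2 hp)], ?_⟩
    · rw [hg]
      exact hm.pos _ (cos_mem_Icc_neg_one_one t)
    · obtain ⟨x, hx, hpx⟩ := hm.exists_curvatureFun_eq hn (hg ε) p
      rw [hpx]
      exact ⟨(hmem x hx).1.le, (hmem x hx).2.le⟩
    · rw [IsMonotoneProfile.smul_refHypersurface_eq_range (k := fun x => 1 + ε * k x) (hg ε)]
      exact hm.isBubble_pole hn (hg ε) (by simp)
  · have hg0 : Tendsto (fun ε => gEps h ε 0) (𝓝 0) (𝓝 1) := by
      have : Continuous fun ε => gEps h ε 0 := by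
        unfold gEps
        fun_prop
      exact this.tendsto' 0 1 (by simp [gEps])
    have := hR.div hg0 one_ne_zero
    rw [div_one] at this
    exact this
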